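/- Notation. $\mathbb T=\mathbb R/2\pi\mathbb Z$; on $\mathbb T^d$, $|\mathbf x-\mathbf y|=\max_i|(x_i-y_i)\bmod 2\pi|$. $C^*(\mathbb T^d)$ is the space of continuous $f:\mathbb T^d\to\mathbb R$ with the supremum norm $\|\cdot\|$. For $n>0$, $\mathbb H_n^d=\mathrm{span}_{\mathbb C}\{e^{i\mathbf k\cdot\mathbf x}:\mathbf k\in\mathbb Z^d,\ |\mathbf k|_2<n\}$ and $E_n(d;f)=\inf_{T\in\mathbb H_n^d}\|f-T\|$. Fix a $C^\infty$ even function $h:\mathbb R\to[0,1]$ with $h(t)=1$ for $|t|\le 1/2$ and $h(t)=0$ for $|t|\ge 1$. For $N>0$ put $\Phi_N(\mathbf x)=\sum_{\mathbf k}h(|\mathbf k|_2/N)e^{i\mathbf k\cdot\mathbf x}$ and $\sigma_N(f)(\mathbf x)=\sum_{\mathbf k}h(|\mathbf k|_2/N)\hat f(\mathbf k)e^{i\mathbf k\cdot\mathbf x}$, where $\hat f(\mathbf k)=(2\pi)^{-d}\int_{\mathbb T^d}f(\mathbf x)e^{-i\mathbf k\cdot\mathbf x}\,d\mathbf x$.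 For a finite $\mathcal C\subset\mathbb T^d$, $\eta(\mathcal C)$ is the minimal distance between distinct points of $\mathcal C$ ($+\infty$ if there are no two distinct points). For $f\in C^*(\mathbb T^d)$ and data $\mathcal D=\{(\mathbf x_j,y_j)\}_{j=1}^M$ in $\mathbb T^d\times\mathbb R$, $T_N^\#(\mathcal D)=\sigma_N(f)+\sum_{p}a_p\Phi_N(\cdot-p)$, where $p$ runs over the distinct points among the $\mathbf x_j$ and the real numbers $a_p$ solve $\sum_p a_p\Phi_N(\mathbf x_\ell-p)=y_\ell-\sigma_N(f)(\mathbf x_\ell)$, $\ell=1,\dots,M$. Let $\mathcal G$ be a finite directed acyclic graph with node set $V\cup\mathbf S$, where $\mathbf S$ is the set of source nodes, and with exactly one sink $v^*$. A source node $v$ receives $d(v)\ge1$ inputs from $\mathbb T$ from outside; a node $v\in V$ receives as its $d(v)$ inputs the outputs of its children, i.e. of the nodes with an edge to $v$. A $\mathcal G$-function is a family $f=\{f_v\}_{v\in V\cup\mathbf S}$ with $f_v\in C^*(\mathbb T^{d(v)})$; the real outputs of the children of $v$ are reduced mod $2\pi$ before $f_v$ is applied. For an input $\mathbf x$ of the whole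 network (one point of $\mathbb T^{d(v)}$ for each $v\in\mathbf S$), let $(\mathbf x)_v\in\mathbb T^{d(v)}$ be the resulting input of $f_v$, and let $f_v[\mathbf x]=f_v((\mathbf x)_v)$ be the resulting output at $v$. Write $\|f\|_{C^*,\mathcal G}=\sum_v\|f_v\|$ and, for $\mathbf N=(N_v)$, $E_{\mathbf N,\mathcal G}(f)=\sum_vE_{N_v}(d(v);f_v)$, the sums being over $V\cup\mathbf S$. Theorem. There is $C=C(\mathcal G)>0$ and, for every $L\ge0$, there is $c=c(\mathcal G,L)>0$ ($C$ and $c$ may also depend on $h$) with the following property. Let $f$ be a $\mathcal G$-function such that $f_v$ is Lipschitz continuous with constant $\le L$ for every $v\in V$. Let $\mathbf x_1,\dots,\mathbf x_M$ be inputs of the network and $y_1,\dots,y_M\in\mathbb R$ such that $y_i=y_j$ whenever $(\mathbf x_i)_{v^*}=(\mathbf x_j)_{v^*}$. Put $\epsilon=\max_j|y_j-f_{v^*}[\mathbf x_j]|$ and $\mathcal C_v=\{(\mathbf x_j)_v: 1\le j\le M\}$, both computed with $f$, and let $N_v>0$ satisfy $N_v\ge C/\eta(\mathcal C_v)$ for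 every $v\in V\cup\mathbf S$. Let $T_{\mathbf N}^\#(\mathcal D)=\{T_v\}$, where $T_v$ is $T^\#_{N_v}$ for the function $f_v$ and the data $((\mathbf x_j)_v,\,f_v((\mathbf x_j)_v))$ if $v\ne v^*$, respectively $((\mathbf x_j)_{v^*},\,y_j)$ if $v=v^*$. Then: 1. $T_{\mathbf N}^\#(\mathcal D)$ is well defined (it exists, is unique and is real valued), and $T_v\in\mathbb H_{N_v}^{d(v)}$ for every $v\in V\cup\mathbf S$; 2. (zero training error) $T_{v^*}[\mathbf x_j]=y_j$ for $j=1,\dots,M$, where $T_{v^*}[\cdot]$ is the output at the sink of the $\mathcal G$-function $\{T_v\}$; 3. (good generalization error) $\|f-T_{\mathbf N}^\#(\mathcal D)\|_{C^*,\mathcal G}\le c\,\{\epsilon+E_{\mathbf N/2,\mathcal G}(f)\}$, and the same bound holds when constituent functions are regarded as functions of all the inputs of the network: $\sum_{v\in V\cup\mathbf S}\sup_{\mathbf x}|f_v[\mathbf x]-T_v[\mathbf x]|\le c\,\{\epsilon+E_{\mathbf N/2,\mathcal G}(f)\}$. -/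

import Mathlib

open scoped NNReal ENNReal ContDiff

noncomputable section

namespace DeepTrig

/-! Trigonometric polynomials on the torus `(ℝ/2πℤ)^ι`, where `ι` is a finite index set. -/

/-- The circle `ℝ/2πℤ`. -/
abbrev Circ : Type := AddCircle (2 * Real.pi)

instance factTwoPi : Fact (0 < 2 * Real.pi) := ⟨Real.two_pi_pos⟩

/-- The torus `(ℝ/2πℤ)^ι`. Its distance is `max_i |(x i - y i) mod 2π|`, and its volume is the
Lebesgue measure, of total mass `(2π)^|ι|`. -/
abbrev Torus (ι : Type*) : Type _ := ι → Circ

/-- The exponential `x ↦ exp(i k·x)`. -/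
def expo {ι : Type*} [Fintype ι] (k : ι → ℤ) : C(Torus ι, ℂ) :=
  ⟨fun x => ∏ i, fourier (k i) (x i), by fun_prop⟩

theorem expo_coe {ι : Type*} [Fintype ι] (k : ι → ℤ) (t : ι → ℝ) :
    expo k (fun i => (t i : Circ)) = Complex.exp (Complex.I * ∑ i, (k i : ℂ) * (t i : ℂ)) := by
  have hpi : (Real.pi : ℂ) ≠ 0 := by exact_mod_cast Real.pi_ne_zero
  rw [Finset.mul_sum, Complex.exp_sum]
  refine Finset.prod_congr rfl fun i _ => ?_
  rw [fourier_coe_apply]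
  congr 1
  push_cast
  field_simp

/-- The Euclidean length of a multi-integer. -/
def len {ι : Type*} [Fintype ι] (k : ι → ℤ) : ℝ := Real.sqrt (∑ i, (k i : ℝ) ^ 2)

/-- The trigonometric polynomials of spherical degree `< n`. -/
def trigPoly (ι : Type*) [Fintype ι] (n : ℝ) : Submodule ℂ C(Torus ι, ℂ) :=
  Submodule.span ℂ (expo '' {k : ι → ℤ | len k < n})

/-- A real continuous function on the torus, seen as a complex one. -/
def toC {ι : Type*} (f : C(Torus ι, ℝ)) : C(Torus ι, ℂ) :=
  ⟨fun x => (f x : ℂ), by fun_prop⟩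

/-- The degree of approximation of `f` in the supremum norm by trigonometric polynomials of
spherical degree `< n`. -/
def degApprox {ι : Type*} [Fintype ι] (n : ℝ) (f : C(Torus ι, ℝ)) : ℝ :=
  ⨅ T : trigPoly ι n, ‖toC f - (T : C(Torus ι, ℂ))‖

/-- The Fourier coefficients `(2π)^(-|ι|) ∫ f(x) exp(-i k·x) dx`. -/
def fourierCoef {ι : Type*} [Fintype ι] (f : C(Torus ι, ℝ)) (k : ι → ℤ) : ℂ :=
  1 / (2 * (Real.pi : ℂ)) ^ Fintype.card ι * ∫ x : Torus ι, (f x : ℂ) * expo (-k) x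

/-- The smooth cutoff functions used to build the kernels. -/
structure IsCutoff (h : ℝ → ℝ) : Prop where
  smooth : ContDiff ℝ ∞ h
  mem_Icc : ∀ t, h t ∈ Set.Icc (0 : ℝ) 1
  even : ∀ t, h (-t) = h t
  eq_one : ∀ t, |t| ≤ 1 / 2 → h t = 1
  eq_zero : ∀ t, 1 ≤ |t| → h t = 0

/-- The kernel `Φ_N = ∑_k h(|k|/N) exp(i k·x)`; the sum is finite when `h` is a cutoff function
and `N > 0`. -/
def kern {ι : Type*} [Fintype ι] (h : ℝ → ℝ) (N : ℝ) : C(Torus ι, ℂ) :=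
  ∑ᶠ k : ι → ℤ, (h (len k / N) : ℂ) • expo k

/-- The summability operator `σ_N(f) = ∑_k h(|k|/N) f̂(k) exp(i k·x)`; the sum is finite as
above. -/
def sigma {ι : Type*} [Fintype ι] (h : ℝ → ℝ) (N : ℝ) (f : C(Torus ι, ℝ)) : C(Torus ι, ℂ) :=
  ∑ᶠ k : ι → ℤ, ((h (len k / N) : ℂ) * fourierCoef f k) • expo k

/-- `T = T^#_N(D)` for the function `f` and the data `D = {(x j, y j)}`: there are real
coefficients `a p`, one for each of the distinct points `p` among the `x j`, with
`∑_p a_p Φ_N(x_l - p) = y_l - σ_N(f)(x_l)` for all `l`, and `T = σ_N(f) + ∑_p a_p Φ_N(· - p)`. -/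
def IsTSharp {ι : Type*} [Fintype ι] (h : ℝ → ℝ) (N : ℝ) (f : C(Torus ι, ℝ)) {M : ℕ}
    (x : Fin M → Torus ι) (y : Fin M → ℝ) (T : C(Torus ι, ℝ)) : Prop :=
  ∃ a : Torus ι → ℝ,
    (∀ l, ∑ p ∈ (Set.finite_range x).toFinset, (a p : ℂ) * kern h N (x l - p)
        = (y l : ℂ) - sigma h N f (x l)) ∧
    ∀ z, (T z : ℂ)
        = sigma h N f z + ∑ p ∈ (Set.finite_range x).toFinset, (a p : ℂ) * kern h N (z - p)

/-! Functions with a compositional structure. -/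

/-- A finite directed acyclic graph with exactly one sink, in which exactly the source nodes
receive inputs from outside; `inDim v` is the number of these inputs. `graph.Adj u v` means that
there is an edge from `u` to `v`, that is, `u` is a child of `v` and the output of `u` is an input
of `v`. -/
structure CompDAG (V : Type*) where
  graph : Digraph V
  acyclic : ∀ v, ¬ Relation.TransGen graph.Adj v v
  sink : V
  sink_iff : ∀ v, (∀ w, ¬ graph.Adj v w) ↔ v = sink
  inDim : V → ℕ
  inDim_pos_iff : ∀ v, 0 < inDim v ↔ ∀ u, ¬ graph.Adj u v

namespace CompDAG

variable {V : Type*}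

/-- A node without in-edges from other nodes. -/
def IsSource (G : CompDAG V) (v : V) : Prop := ∀ u, ¬ G.graph.Adj u v

/-- The index set of the inputs of the node `v`: its children and its outside inputs (one of the
two parts is empty). Its cardinality is the in-degree `d(v)`. -/
def Inp (G : CompDAG V) (v : V) : Type _ := {u : V // G.graph.Adj u v} ⊕ Fin (G.inDim v)

instance [Finite V] (G : CompDAG V) (v : V) : Finite (G.Inp v) :=
  inferInstanceAs (Finite ({u : V // G.graph.Adj u v} ⊕ Fin (G.inDim v)))

instance [Finite V] (G : CompDAG V) (v : V) : Fintype (G.Inp v) := Fintype.ofFinite _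

/-- A `G`-function: a continuous constituent function `f_v : T^{d(v)} → ℝ` for each node. -/
abbrev Fn (G : CompDAG V) : Type _ := ∀ v, C(Torus (G.Inp v), ℝ)

/-- The inputs `x = ((x)_v)` of the whole network, grouped by source nodes. -/
abbrev Input (G : CompDAG V) : Type _ := ∀ v, Torus (Fin (G.inDim v))

theorem wf [Finite V] (G : CompDAG V) : WellFounded G.graph.Adj := by
  have : Std.Irrefl (Relation.TransGen G.graph.Adj) := ⟨G.acyclic⟩
  exact Subrelation.wf (fun h => Relation.TransGen.single h)
    (Finite.wellFounded_of_trans_of_irrefl (Relation.TransGen G.graph.Adj))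

/-- The output at the node `v`, as a function of all the inputs of the network: the real outputs
of the children are reduced mod `2π` and passed on to the constituent function of `v`. -/
def eval [Finite V] (G : CompDAG V) (f : G.Fn) (x : G.Input) : V → ℝ :=
  G.wf.fix fun v ih => f v (Sum.elim (fun u => ((ih u.1 u.2 : ℝ) : Circ)) (x v))

/-- The point of `T^{d(v)}` seen by the node `v` when `x` is the input of the network. -/
def seen [Finite V] (G : CompDAG V) (f : G.Fn) (x : G.Input) (v : V) : Torus (G.Inp v) :=
  Sum.elim (fun u => ((G.eval f x u.1 : ℝ) : Circ)) (x v)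

theorem eval_eq [Finite V] (G : CompDAG V) (f : G.Fn) (x : G.Input) (v : V) :
    G.eval f x v = f v (G.seen f x v) :=
  G.wf.fix_eq _ v

/-- The set `C_v` of training points seen by the node `v`. -/
def points [Finite V] (G : CompDAG V) (f : G.Fn) {M : ℕ} (x : Fin M → G.Input) (v : V) :
    Set (Torus (G.Inp v)) :=
  Set.range fun j => G.seen f (x j) v

/-- The noise level `ε = max_j |y_j - f(x_j)|`. -/
def noise [Finite V] (G : CompDAG V) (f : G.Fn) {M : ℕ} (x : Fin M → G.Input)
    (y : Fin M → ℝ) : ℝ :=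
  ⨆ j, |y j - G.eval f (x j) G.sink|

/-- The norm `∑_v ‖f_v‖`, where `f_v` is a function on `T^{d(v)}`. -/
def norm [Fintype V] (G : CompDAG V) (f : G.Fn) : ℝ := ∑ v, ‖f v‖

/-- The sum over the nodes of the uniform distance between the outputs of `f` and of `g`, as
functions of all the inputs of the network (each supremum is at most `‖f v‖ + ‖g v‖`). -/
def outputDist [Fintype V] (G : CompDAG V) (f g : G.Fn) : ℝ :=
  ∑ v, ⨆ x : G.Input, |G.eval f x v - G.eval g x v|

/-- The degree of approximation `∑_v E_{n_v}(d(v); f_v)`. -/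
def degApprox [Fintype V] (G : CompDAG V) (n : V → ℝ) (f : G.Fn) : ℝ :=
  ∑ v, DeepTrig.degApprox (n v) (f v)

/-- `T` is a `G`-function of trigonometric polynomials of spherical degrees `< n_v`. -/
def IsTrigPoly [Finite V] (G : CompDAG V) (n : V → ℝ) (T : G.Fn) : Prop :=
  ∀ v, toC (T v) ∈ trigPoly (G.Inp v) (n v)

open Classical in
/-- `T = T^#_N(D)` for the `G`-function `f` and the data `D = {(x j, y j)}`: at each node `v`, the
constituent function is `T^#_{N_v}` for `f_v` and the data seen by `v`. The labels are the given
`y j` at the sink and the exact values of `f_v` at the other nodes. -/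
def IsTSharp [Finite V] (G : CompDAG V) (h : ℝ → ℝ) (N : V → ℝ) (f : G.Fn) {M : ℕ}
    (x : Fin M → G.Input) (y : Fin M → ℝ) (T : G.Fn) : Prop :=
  ∀ v, DeepTrig.IsTSharp h (N v) (f v) (fun j => G.seen f (x j) v)
    (fun j => if v = G.sink then y j else f v (G.seen f (x j) v)) (T v)

end CompDAG

end DeepTrig

end

/-!
Everything rests on the localization of the kernel: with `d = |ι|` and `N ≥ 1`,
`|Φ_N(x)| ≤ K N^d (1 + (N|x|)²)^{-(d+1)}`. It comes from summation by parts (`pow_mul_trigSum`):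
multiplying `Φ_N` by `(exp(-i x_j) - 1)^S` replaces its coefficients `h(|k|/N)` by their `S`-fold
differences in direction `j`, which are `O(N^{-S})` because `v ↦ h(|v|)` is smooth and compactly
supported (`exists_fwdDiff_iter_bound`), while only `O(N^d)` of them are nonzero. The bound is used
in the form `exists_kern_decay`, with the isotropic decay weakened to a product over the
coordinates and one further factor `(1 + (N|x|)²)⁻¹`, so that integrals and lattice sums factor
into one-dimensional ones. For `N ≤ 1` the kernel is that of `N = 1`, so the restriction `N ≥ 1`
is harmless.

Two consequences settle the problem at a single node (`IsCutoff.exists_interpolation`).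

* The kernels are bounded in `L¹`, so the operators `σ_N` are bounded uniformly in `N`. As `σ_N`
  reproduces trigonometric polynomials of degree less than `N / 2`, `‖f - σ_N f‖` is at most a
  constant times the degree of approximation (`IsCutoff.exists_norm_sub_sigma_le`).
* Since `Φ_N(0)` is at least a multiple of `N^d`, for points whose mutual distances are at least
  `C / N` with `C` large the matrix `Φ_N(q - p)` is diagonally dominant and
  `∑_p |Φ_N(z - p)| ≤ D Φ_N(0)` for all `z` (`IsCutoff.exists_sum_kern_le`). Hence the coefficients
  `a_p` exist, are unique, and the correction `∑_p a_p Φ_N(· - p)` is bounded by a constant times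
  the largest residual `|y_j - σ_N f(x_j)| ≤ ε + ‖f - σ_N f‖`.

In the network, the sink feeds no other node, and the constituents of `T` at the other nodes
interpolate those of `f` at the points seen during the evaluation of `f`. By induction along the
graph every node sees the same training points for `T` as for `f`
(`CompDAG.seen_eq_of_interpolates`), so `T` reproduces the labels. A similar induction, with the
Lipschitz condition at the inner nodes, bounds the error of all outputs by a constant times
`∑_v ‖f_v - T_v‖` (`CompDAG.exists_outputDist_le`).
-/

noncomputable section

namespace DeepTrig

/-! ### Iterated differences of smooth functions -/

theorem hasDerivAt_fwdDiff_iter {E : Type*} [NormedAddCommGroup E] [NormedSpace ℝ E] (e v : E)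
    (S : ℕ) : ∀ F F' : E → ℝ,
      (∀ x (t : ℝ), HasDerivAt (fun t : ℝ => F (x + t • e)) (F' (x + t • e)) t) →
      ∀ x (t : ℝ), HasDerivAt (fun t : ℝ => (fwdDiff v)^[S] F (x + t • e))
        ((fwdDiff v)^[S] F' (x + t • e)) t := by
  induction S with
  | zero => intro F F' hF; simpa using hF
  | succ S ih =>
    intro F F' hF
    simp only [Function.iterate_succ, Function.comp_apply]
    refine ih _ _ fun x t => ?_
    have h1 := (hF (x + v) t).sub (hF x t)
    have e1 : ∀ t : ℝ, x + v + t • e = x + t • e + v := fun t => by abel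
    simp only [e1] at h1
    exact h1

/-- An `S`-fold difference with step `ε • e` of a smooth compactly supported function is
`O(ε ^ S)`, uniformly in the base point. -/
theorem exists_fwdDiff_iter_bound {E : Type*} [NormedAddCommGroup E] [NormedSpace ℝ E] (e : E)
    (S : ℕ) : ∀ F : E → ℝ, ContDiff ℝ ∞ F → HasCompactSupport F →
      ∃ C, 0 ≤ C ∧ ∀ ε : ℝ, 0 ≤ ε → ∀ x, |(fwdDiff (ε • e))^[S] F x| ≤ C * ε ^ S := by
  induction S with
  | zero =>
    intro F hF hc
    obtain ⟨C, hC⟩ := hc.exists_bound_of_continuous hF.continuous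
    refine ⟨C, (norm_nonneg _).trans (hC 0), fun ε _ x => ?_⟩
    simpa using hC x
  | succ S ih =>
    intro F hF hc
    set F' : E → ℝ := fun x => fderiv ℝ F x e with hF'
    obtain ⟨C, hC0, hC⟩ := ih F'
      ((hF.fderiv_right (m := ∞) (by simp)).clm_apply contDiff_const) (hc.fderiv_apply ℝ e)
    refine ⟨C, hC0, fun ε hε x => ?_⟩
    have hd : ∀ x (t : ℝ), HasDerivAt (fun t : ℝ => F (x + t • e)) (F' (x + t • e)) t := by
      intro x t
      have h1 : HasFDerivAt F (fderiv ℝ F (x + t • e)) (x + t • e) :=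
        ((hF.differentiable (by simp)) _).hasFDerivAt
      have h2 : HasDerivAt (fun t : ℝ => x + t • e) e t := by
        simpa using ((hasDerivAt_id t).smul_const e).const_add x
      exact h1.comp_hasDerivAt t h2
    have hd' := hasDerivAt_fwdDiff_iter e (ε • e) S F F' hd x
    have hm := (convex_univ (𝕜 := ℝ) (E := ℝ)).norm_image_sub_le_of_norm_hasDerivWithin_le
      (x := 0) (y := ε) (fun t _ => (hd' t).hasDerivWithinAt)
      (fun t _ => hC ε hε (x + t • e)) (Set.mem_univ _) (Set.mem_univ _)
    simp only [zero_smul, add_zero, sub_zero, Real.norm_eq_abs, abs_of_nonneg hε] at hm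
    rw [Function.iterate_succ_apply', pow_succ, ← mul_assoc]
    exact hm

/-- Differences of a function sampled along a homomorphism are samples of its differences. -/
theorem fwdDiff_iter_comp {A E : Type*} [AddCommGroup A] [AddCommGroup E] (φ : A →+ E) (v : A)
    (S : ℕ) : ∀ (F : E → ℝ) (k : A),
      (fwdDiff v)^[S] (fun k => (F (φ k) : ℂ)) k = (((fwdDiff (φ v))^[S] F (φ k) : ℝ) : ℂ) := by
  induction S with
  | zero => intro F k; simp
  | succ S ih =>
    intro F k
    have h1 : fwdDiff v (fun k => (F (φ k) : ℂ))
        = fun k => ((fwdDiff (φ v) F (φ k) : ℝ) : ℂ) := by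
      funext k
      simp [fwdDiff]
    rw [Function.iterate_succ_apply, Function.iterate_succ_apply, h1, ih]

/-! ### Exponentials and trigonometric sums -/

variable {ι : Type*} [Fintype ι]

theorem expo_apply (k : ι → ℤ) (x : Torus ι) : expo k x = ∏ i, fourier (k i) (x i) := rfl

theorem expo_add (k l : ι → ℤ) (x : Torus ι) : expo (k + l) x = expo k x * expo l x := by
  simp [expo_apply, Finset.prod_mul_distrib]

theorem expo_neg (k : ι → ℤ) (x : Torus ι) : expo (-k) x = starRingEnd ℂ (expo k x) := by
  simp [expo_apply]

theorem expo_apply_neg (k : ι → ℤ) (x : Torus ι) : expo k (-x) = expo (-k) x := by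
  simp [expo_apply, fourier_apply]

theorem expo_apply_add (k : ι → ℤ) (x y : Torus ι) :
    expo k (x + y) = expo k x * expo k y := by
  simp [expo_apply, fourier_apply, Finset.prod_mul_distrib, AddCircle.toCircle_add, smul_add]

theorem expo_apply_sub (k : ι → ℤ) (x y : Torus ι) :
    expo k (x - y) = expo k x * expo (-k) y := by
  rw [sub_eq_add_neg, expo_apply_add, expo_apply_neg]

theorem norm_expo (k : ι → ℤ) (x : Torus ι) : ‖expo k x‖ = 1 := by
  simp only [expo_apply, fourier_apply, norm_prod, Circle.norm_coe, Finset.prod_const_one]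

theorem expo_apply_zero (k : ι → ℤ) : expo k (0 : Torus ι) = 1 := by
  simp [expo_apply, fourier_apply]

theorem expo_single [DecidableEq ι] (j : ι) (x : Torus ι) :
    expo (Pi.single j 1) x = fourier 1 (x j) := by
  rw [expo_apply, Finset.prod_eq_single j]
  · simp
  · intro i _ hi; simp [Pi.single_eq_of_ne hi]
  · simp

/-- The trigonometric sum `∑ a k exp(i k·x)` with finitely many nonzero coefficients; junk
otherwise. -/
def trigSum (a : (ι → ℤ) → ℂ) : C(Torus ι, ℂ) := ∑ᶠ k, a k • expo k

theorem trigSum_eq_sum {a : (ι → ℤ) → ℂ} {s : Finset (ι → ℤ)} (hs : ∀ k ∉ s, a k = 0) :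
    trigSum a = ∑ k ∈ s, a k • expo k := by
  refine finsum_eq_sum_of_support_subset _ fun k hk => ?_
  by_contra hk'
  exact hk (by simp [hs k hk'])

theorem trigSum_apply {a : (ι → ℤ) → ℂ} {s : Finset (ι → ℤ)} (hs : ∀ k ∉ s, a k = 0)
    (x : Torus ι) : trigSum a x = ∑ k ∈ s, a k * expo k x := by
  simp [trigSum_eq_sum hs, ContinuousMap.sum_apply]

theorem trigSum_apply_finsum {a : (ι → ℤ) → ℂ} (ha : a.HasFiniteSupport) (x : Torus ι) :
    trigSum a x = ∑ᶠ k, a k * expo k x := by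
  have hs : ∀ k ∉ Set.Finite.toFinset (s := a.support) ha, a k = 0 := by
    intro k hk
    by_contra h
    exact hk ((Set.Finite.mem_toFinset _).2 h)
  rw [trigSum_apply hs, finsum_eq_sum_of_support_subset]
  intro k hk
  by_contra hk'
  exact hk (by simp [hs k hk'])

theorem hasFiniteSupport_fwdDiff {A : Type*} [AddCommGroup A] {a : A → ℂ}
    (ha : a.HasFiniteSupport) (v : A) : (fwdDiff v a).HasFiniteSupport := by
  have h1 : (fun k => a (k + v)).HasFiniteSupport :=
    Set.Finite.preimage (add_left_injective v).injOn ha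
  exact h1.sub ha

/-- Summation by parts: differencing the coefficients multiplies a trigonometric sum by
`exp(-i v·x) - 1`. -/
theorem mul_trigSum {a : (ι → ℤ) → ℂ} (ha : a.HasFiniteSupport) (v : ι → ℤ) (x : Torus ι) :
    (expo (-v) x - 1) * trigSum a x = trigSum (fwdDiff v a) x := by
  have h1 : (fun k => a (k + v)).HasFiniteSupport :=
    Set.Finite.preimage (add_left_injective v).injOn ha
  have h2 : expo (-v) x * trigSum a x = ∑ᶠ k, a (k + v) * expo k x := by
    rw [trigSum_apply_finsum ha, ← finsum_comp_equiv (Equiv.addRight v), mul_finsum]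
    · refine finsum_congr fun k => ?_
      simp only [Equiv.coe_addRight, expo_add, expo_neg]
      have : starRingEnd ℂ (expo v x) * expo v x = 1 := by
        rw [← Complex.normSq_eq_conj_mul_self, Complex.normSq_eq_norm_sq, norm_expo]; simp
      linear_combination (a (k + v) * expo k x) * this
  rw [sub_mul, one_mul, h2, trigSum_apply_finsum ha,
    trigSum_apply_finsum (hasFiniteSupport_fwdDiff ha v), ← finsum_sub_distrib]
  · simp only [fwdDiff, sub_mul]
  · exact h1.subset fun k hk hk' => hk (by simp_all)
  · exact ha.subset fun k hk hk' => hk (by simp_all)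

theorem pow_mul_trigSum (v : ι → ℤ) (x : Torus ι) (S : ℕ) :
    ∀ a : (ι → ℤ) → ℂ, a.HasFiniteSupport →
      (expo (-v) x - 1) ^ S * trigSum a x = trigSum ((fwdDiff v)^[S] a) x := by
  induction S with
  | zero => intro a _; simp
  | succ S ih =>
    intro a ha
    rw [Function.iterate_succ_apply, ← ih _ (hasFiniteSupport_fwdDiff ha v), ← mul_trigSum ha]
    ring

/-- The multi-integers with entries of size at most `R`. -/
def box (ι : Type*) [Fintype ι] (R : ℕ) : Finset (ι → ℤ) :=
  open Classical in Fintype.piFinset fun _ => Finset.Icc (-(R : ℤ)) R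

theorem mem_box {R : ℕ} {k : ι → ℤ} : k ∈ box ι R ↔ ∀ i, |k i| ≤ R := by
  simp [box, Fintype.mem_piFinset, abs_le]

theorem card_box (R : ℕ) : (box ι R).card = (2 * R + 1) ^ Fintype.card ι := by
  classical
  simp only [box, Fintype.card_piFinset, Int.card_Icc, Finset.prod_const, Finset.card_univ]
  congr 1
  omega

theorem norm_trigSum_le {a : (ι → ℤ) → ℂ} {R : ℕ} {A : ℝ} (ha : ∀ k ∉ box ι R, a k = 0)
    (hA : ∀ k, ‖a k‖ ≤ A) (x : Torus ι) :
    ‖trigSum a x‖ ≤ (2 * R + 1) ^ Fintype.card ι * A := by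
  rw [trigSum_apply ha]
  refine (norm_sum_le_of_le _ (f := fun k => a k * expo k x) (n := fun _ => A)
    fun k _ => ?_).trans ?_
  · simpa [norm_expo] using hA k
  · simp [card_box]

/-- Each difference enlarges the box that carries the coefficients by at most one. -/
theorem fwdDiff_iter_eq_zero [DecidableEq ι] (j : ι) (S : ℕ) : ∀ (R : ℕ) (a : (ι → ℤ) → ℂ),
    (∀ k ∉ box ι R, a k = 0) →
      ∀ k ∉ box ι (R + S), (fwdDiff (Pi.single j 1 : ι → ℤ))^[S] a k = 0 := by
  induction S with
  | zero => intro R a ha; simpa using ha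
  | succ S ih =>
    intro R a ha k hk
    rw [Function.iterate_succ_apply]
    refine ih (R + 1) _ (fun k hk => ?_) k (by rwa [add_assoc, add_comm 1])
    rw [fwdDiff, ha k, ha, sub_zero]
    · intro h
      refine hk (mem_box.2 fun i => ?_)
      have := mem_box.1 h i
      rw [abs_le] at this ⊢
      by_cases hi : i = j
      · subst hi; simp at this; push_cast; constructor <;> linarith
      · simp [Pi.single_eq_of_ne hi] at this; push_cast; constructor <;> linarith
    · intro h
      refine hk (mem_box.2 fun i => (mem_box.1 h i).trans ?_)
      push_cast; linarith

/-! ### Representatives on the circle -/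

theorem Circ.exists_rep (t : Circ) : ∃ r : ℝ, (r : Circ) = t ∧ |r| = ‖t‖ := by
  induction t using QuotientAddGroup.induction_on with
  | H x =>
    refine ⟨x - round ((2 * Real.pi)⁻¹ * x) * (2 * Real.pi), ?_, (AddCircle.norm_eq _).symm⟩
    rw [← zsmul_eq_mul]
    rw [AddCircle.coe_sub, AddCircle.coe_zsmul, AddCircle.coe_period, smul_zero, sub_zero]

theorem Circ.norm_coe_le (r : ℝ) : ‖(r : Circ)‖ ≤ |r| := by
  exact QuotientAddGroup.norm_mk_le_norm

theorem Circ.norm_le_pi (t : Circ) : ‖t‖ ≤ Real.pi := by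
  have := AddCircle.norm_le_half_period (2 * Real.pi) (x := t) (by positivity)
  rw [abs_of_pos (by positivity)] at this
  linarith

theorem Circ.le_norm_fourier_sub_one (t : Circ) : 2 / Real.pi * ‖t‖ ≤ ‖fourier (-1) t - 1‖ := by
  have h0 : ‖fourier (-1) t - 1‖ = ‖fourier 1 t - 1‖ := by
    rw [fourier_neg, ← RCLike.norm_conj]; simp
  obtain ⟨r, rfl, hr⟩ := Circ.exists_rep t
  have hpi := Real.pi_pos
  have h1 : fourier 1 (r : Circ) = Complex.exp (Complex.I * r) := by
    rw [fourier_coe_apply]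
    congr 1
    have hpi : (Real.pi : ℂ) ≠ 0 := by exact_mod_cast Real.pi_ne_zero
    push_cast
    field_simp
  rw [h0, h1, Complex.norm_exp_I_mul_ofReal_sub_one, ← hr, Real.norm_eq_abs, abs_mul, abs_two]
  have h2 : |r| ≤ Real.pi := hr ▸ Circ.norm_le_pi _
  have h3 := Real.mul_le_sin (x := |r| / 2) (by positivity) (by linarith)
  have h4 : Real.sin (|r| / 2) ≤ |Real.sin (r / 2)| := by
    rcases abs_choice r with h | h <;> rw [h]
    · exact le_abs_self _
    · rw [neg_div, Real.sin_neg]; exact neg_le_abs _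
  calc 2 / Real.pi * |r| = 2 * (2 / Real.pi * (|r| / 2)) := by ring
    _ ≤ _ := by linarith

/-! ### Size and decay of the kernel -/

theorem abs_le_len (k : ι → ℤ) (i : ι) : |(k i : ℝ)| ≤ len k := by
  refine Real.le_sqrt_of_sq_le ?_
  rw [sq_abs]
  exact Finset.single_le_sum (f := fun i => (k i : ℝ) ^ 2) (fun i _ => sq_nonneg _)
    (Finset.mem_univ i)

theorem len_nonneg (k : ι → ℤ) : 0 ≤ len k := Real.sqrt_nonneg _

theorem len_neg (k : ι → ℤ) : len (-k) = len k := by simp [len]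

theorem len_zero : len (0 : ι → ℤ) = 0 := by simp [len]

theorem one_le_len {k : ι → ℤ} (hk : k ≠ 0) : 1 ≤ len k := by
  obtain ⟨i, hi⟩ := Function.ne_iff.1 hk
  refine le_trans ?_ (abs_le_len k i)
  exact_mod_cast Int.one_le_abs hi

theorem len_le_sum (k : ι → ℤ) : len k ≤ ∑ i, |(k i : ℝ)| := by
  refine Real.sqrt_le_iff.2 ⟨Finset.sum_nonneg fun i _ => abs_nonneg _, ?_⟩
  simpa using Finset.sum_sq_le_sq_sum_of_nonneg (s := Finset.univ) (f := fun i => |(k i : ℝ)|)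
    fun i _ => abs_nonneg _

namespace IsCutoff

variable {h : ℝ → ℝ} (hh : IsCutoff h)

include hh

theorem coeff_eq_zero {N : ℝ} (hN : 0 < N) {R : ℕ} (hR : N ≤ R) (k : ι → ℤ) (hk : k ∉ box ι R) :
    h (len k / N) = 0 := by
  refine hh.eq_zero _ ?_
  simp only [mem_box, not_forall, not_le] at hk
  obtain ⟨i, hi⟩ := hk
  have h1 : (R : ℝ) < |(k i : ℝ)| := by exact_mod_cast hi
  have h2 := abs_le_len k i
  rw [abs_of_nonneg (div_nonneg (len_nonneg k) hN.le), one_le_div hN]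
  linarith

/-- The norm is not smooth at the origin, but the cutoff is constant near there. -/
theorem contDiff_comp_norm {E : Type*} [NormedAddCommGroup E] [InnerProductSpace ℝ E] :
    ContDiff ℝ ∞ fun v : E => h ‖v‖ := by
  rw [contDiff_iff_contDiffAt]
  intro v
  by_cases hv : v = 0
  · refine (contDiffAt_const (c := (1 : ℝ))).congr_of_eventuallyEq ?_
    filter_upwards [Metric.ball_mem_nhds v (show (0 : ℝ) < 1 / 2 by norm_num)] with w hw
    rw [hv, mem_ball_zero_iff] at hw
    exact hh.eq_one _ (by rw [abs_norm]; exact hw.le)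
  · exact hh.smooth.contDiffAt.comp v (contDiffAt_norm ℝ hv)

theorem hasCompactSupport_comp_norm {E : Type*} [NormedAddCommGroup E] [ProperSpace E] :
    HasCompactSupport fun v : E => h ‖v‖ := by
  refine HasCompactSupport.intro (isCompact_closedBall (0 : E) 1) fun v hv => ?_
  rw [mem_closedBall_zero_iff, not_le] at hv
  exact hh.eq_zero _ (by rw [abs_norm]; exact hv.le)

end IsCutoff

/-- The scaling `k ↦ k / N` from multi-integers into Euclidean space. -/
def scaleHom (ι : Type*) [Fintype ι] (N : ℝ) : (ι → ℤ) →+ EuclideanSpace ℝ ι where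
  toFun k := WithLp.toLp 2 fun i => (k i : ℝ) / N
  map_zero' := by ext i; simp
  map_add' k l := by ext i; simp [add_div]

theorem norm_scaleHom {N : ℝ} (hN : 0 < N) (k : ι → ℤ) : ‖scaleHom ι N k‖ = len k / N := by
  rw [EuclideanSpace.norm_eq, len]
  simp only [scaleHom, AddMonoidHom.coe_mk, ZeroHom.coe_mk, Real.norm_eq_abs, sq_abs, div_pow]
  rw [← Finset.sum_div, Real.sqrt_div' _ (sq_nonneg N), Real.sqrt_sq hN.le]

theorem scaleHom_single [DecidableEq ι] (N : ℝ) (j : ι) :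
    scaleHom ι N (Pi.single j 1) = (1 / N) • EuclideanSpace.single j (1 : ℝ) := by
  ext i
  by_cases hi : i = j
  · subst hi; simp [scaleHom]
  · simp [scaleHom, hi]

theorem kern_eq_trigSum (h : ℝ → ℝ) (N : ℝ) :
    (kern h N : C(Torus ι, ℂ)) = trigSum fun k => (h (len k / N) : ℂ) := rfl

theorem hasFiniteSupport_of_box {a : (ι → ℤ) → ℂ} {R : ℕ} (ha : ∀ k ∉ box ι R, a k = 0) :
    a.HasFiniteSupport :=
  (box ι R).finite_toSet.subset fun k hk => by
    by_contra hk'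
    exact hk (ha k hk')

theorem ceil_bound {N : ℝ} (hN : 1 ≤ N) (S : ℕ) :
    2 * ((⌈N⌉₊ + S : ℕ) : ℝ) + 1 ≤ (2 * S + 5) * N := by
  have := (Nat.ceil_lt_add_one (zero_le_one.trans hN)).le
  push_cast
  nlinarith [Nat.cast_nonneg (α := ℝ) S]

/-- Decay in one coordinate, by `S`-fold summation by parts: the differenced coefficients are
`O(N ^ (-S))`, and `O(N ^ |ι|)` of them are nonzero. -/
theorem exists_coord_decay {h : ℝ → ℝ} (hh : IsCutoff h) (j : ι) (S : ℕ) :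
    ∃ K, 0 ≤ K ∧ ∀ N : ℝ, 1 ≤ N → ∀ x : Torus ι,
      (N * ‖x j‖) ^ S * ‖kern h N x‖ ≤ K * N ^ Fintype.card ι := by
  classical
  obtain ⟨C, hC0, hC⟩ := exists_fwdDiff_iter_bound (EuclideanSpace.single j (1 : ℝ)) S
    (fun v : EuclideanSpace ℝ ι => h ‖v‖) hh.contDiff_comp_norm hh.hasCompactSupport_comp_norm
  refine ⟨(Real.pi / 2) ^ S * ((2 * S + 5) ^ Fintype.card ι * C), by positivity,
    fun N hN x => ?_⟩
  have hN0 : 0 < N := by linarith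
  have ha : ∀ k ∉ box ι ⌈N⌉₊, (h (len k / N) : ℂ) = 0 := fun k hk => by
    rw [hh.coeff_eq_zero hN0 (Nat.le_ceil N) k hk, Complex.ofReal_zero]
  have h1 := pow_mul_trigSum (Pi.single j 1) x S _ (hasFiniteSupport_of_box ha)
  have h2 : ∀ k, ‖(fwdDiff (Pi.single j 1 : ι → ℤ))^[S] (fun k => (h (len k / N) : ℂ)) k‖
      ≤ C * (1 / N) ^ S := by
    intro k
    have := fwdDiff_iter_comp (scaleHom ι N) (Pi.single j 1) S (fun v => h ‖v‖) k
    simp only [norm_scaleHom hN0] at this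
    rw [this, Complex.norm_real, scaleHom_single]
    exact hC _ (by positivity) _
  have h3 := norm_trigSum_le (fwdDiff_iter_eq_zero j S _ _ ha) h2 x
  rw [← h1, norm_mul, norm_pow, expo_neg, expo_single, ← fourier_neg, ← kern_eq_trigSum] at h3
  have h4 := Circ.le_norm_fourier_sub_one (x j)
  have hpi := Real.pi_pos
  calc (N * ‖x j‖) ^ S * ‖kern h N x‖
      = (Real.pi / 2 * N) ^ S * ((2 / Real.pi * ‖x j‖) ^ S * ‖kern h N x‖) := by
        rw [← mul_assoc, ← mul_pow]; congr 2; field_simp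
    _ ≤ (Real.pi / 2 * N) ^ S * (‖fourier (-1) (x j) - 1‖ ^ S * ‖kern h N x‖) := by gcongr
    _ ≤ (Real.pi / 2 * N) ^ S
        * (((2 * S + 5) * N) ^ Fintype.card ι * (C * (1 / N) ^ S)) := by
        refine mul_le_mul_of_nonneg_left (h3.trans ?_) (by positivity)
        gcongr
        exact ceil_bound hN S
    _ = (Real.pi / 2) ^ S * ((2 * S + 5) ^ Fintype.card ι * C) * N ^ Fintype.card ι := by
        rw [mul_pow, mul_pow, one_div, inv_pow]; field_simp

theorem norm_kern_le {h : ℝ → ℝ} (hh : IsCutoff h) {N : ℝ} (hN : 1 ≤ N) (x : Torus ι) :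
    ‖kern h N x‖ ≤ 5 ^ Fintype.card ι * N ^ Fintype.card ι := by
  have hN0 : 0 < N := by linarith
  have ha : ∀ k ∉ box ι ⌈N⌉₊, (h (len k / N) : ℂ) = 0 := fun k hk => by
    rw [hh.coeff_eq_zero hN0 (Nat.le_ceil N) k hk, Complex.ofReal_zero]
  have h1 := norm_trigSum_le ha (A := 1) (fun k => by
    rw [Complex.norm_real, Real.norm_eq_abs, abs_of_nonneg (hh.mem_Icc _).1]
    exact (hh.mem_Icc _).2) x
  rw [kern_eq_trigSum, ← mul_pow]
  refine h1.trans ?_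
  rw [mul_one]
  gcongr
  simpa using ceil_bound hN 0

theorem exists_norm_decay {h : ℝ → ℝ} (hh : IsCutoff h) (S : ℕ) :
    ∃ K, 0 ≤ K ∧ ∀ N : ℝ, 1 ≤ N → ∀ x : Torus ι,
      (N * ‖x‖) ^ (S + 1) * ‖kern h N x‖ ≤ K * N ^ Fintype.card ι := by
  choose K hK0 hK using fun j : ι => exists_coord_decay hh j (S + 1)
  refine ⟨∑ j, K j, Finset.sum_nonneg fun j _ => hK0 j, fun N hN x => ?_⟩
  have hN0 : 0 < N := by linarith
  rcases isEmpty_or_nonempty ι with hι | hι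
  · have : ‖x‖ = 0 := by rw [Subsingleton.elim x 0, norm_zero]
    simp [this]
  · obtain ⟨j, hj⟩ := Finite.exists_max fun j => ‖x j‖
    have : ‖x‖ = ‖x j‖ :=
      le_antisymm ((pi_norm_le_iff_of_nonneg (norm_nonneg _)).2 hj) (norm_le_pi_norm x j)
    rw [this]
    refine (hK j N hN x).trans ?_
    gcongr
    exact Finset.single_le_sum (fun j _ => hK0 j) (Finset.mem_univ j)

/-- Localization of the kernel. The product over the coordinates makes integrals and sums over
separated points factor into one-dimensional ones; the last factor is small away from the
origin. -/
theorem exists_kern_decay (ι : Type*) [Fintype ι] {h : ℝ → ℝ} (hh : IsCutoff h) :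
    ∃ K, 0 < K ∧ ∀ N : ℝ, 1 ≤ N → ∀ x : Torus ι,
      ‖kern h N x‖ ≤ K * N ^ Fintype.card ι
        * ((∏ i, (1 + (N * ‖x i‖) ^ 2)⁻¹) * (1 + (N * ‖x‖) ^ 2)⁻¹) := by
  set d := Fintype.card ι with hd
  obtain ⟨K, hK0, hK⟩ := exists_norm_decay (ι := ι) hh (2 * d + 1)
  refine ⟨2 ^ d * (5 ^ d + K), by positivity, fun N hN x => ?_⟩
  have hN0 : 0 < N := by linarith
  have h1 : ∏ i, (1 + (N * ‖x i‖) ^ 2) ≤ (1 + (N * ‖x‖) ^ 2) ^ d := by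
    rw [hd, ← Finset.card_univ, ← Finset.prod_const]
    refine Finset.prod_le_prod (fun i _ => by positivity) fun i _ => ?_
    have := norm_le_pi_norm x i
    gcongr
  rw [Finset.prod_inv_distrib, ← mul_inv, ← div_eq_mul_inv, le_div_iff₀ (by positivity)]
  have h2 := norm_kern_le hh hN x
  have h3 := hK N hN x
  calc ‖kern h N x‖ * ((∏ i, (1 + (N * ‖x i‖) ^ 2)) * (1 + (N * ‖x‖) ^ 2))
      ≤ ‖kern h N x‖ * ((1 + (N * ‖x‖) ^ 2) ^ d * (1 + (N * ‖x‖) ^ 2)) := by gcongr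
    _ = ‖kern h N x‖ * (1 + (N * ‖x‖) ^ 2) ^ (d + 1) := by ring
    _ ≤ ‖kern h N x‖ * (2 ^ d * (1 ^ (d + 1) + ((N * ‖x‖) ^ 2) ^ (d + 1))) := by
        gcongr
        exact add_pow_le zero_le_one (by positivity) (d + 1)
    _ = 2 ^ d * (‖kern h N x‖ + (N * ‖x‖) ^ (2 * d + 1 + 1) * ‖kern h N x‖) := by ring
    _ ≤ 2 ^ d * (5 ^ d * N ^ d + K * N ^ d) := by gcongr
    _ = _ := by ring

theorem conj_trigSum {a : (ι → ℤ) → ℂ} (ha : a.HasFiniteSupport) (x : Torus ι) :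
    starRingEnd ℂ (trigSum a x) = trigSum (fun k => starRingEnd ℂ (a (-k))) x := by
  have h1 : (fun k => starRingEnd ℂ (a (-k))).HasFiniteSupport :=
    (Set.Finite.preimage neg_injective.injOn ha).subset fun k hk hk' => hk (by simp_all)
  rw [trigSum_apply_finsum ha, trigSum_apply_finsum h1,
    ← finsum_comp_equiv (Equiv.neg (ι → ℤ))]
  refine ((starRingEnd ℂ).toAddMonoidHom.map_finsum ?_).trans (finsum_congr fun k => ?_)
  · exact (Set.Finite.preimage neg_injective.injOn ha).subset fun k hk hk' => hk (by simp_all)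
  · simp [expo_neg]

theorem trigSum_real {a : (ι → ℤ) → ℂ} (ha : a.HasFiniteSupport)
    (hs : ∀ k, starRingEnd ℂ (a (-k)) = a k) (x : Torus ι) :
    ((trigSum a x).re : ℂ) = trigSum a x := by
  rw [← Complex.conj_eq_iff_re, conj_trigSum ha]
  simp only [hs]

namespace IsCutoff

variable {h : ℝ → ℝ} (hh : IsCutoff h)

include hh

theorem hasFiniteSupport_coeff {N : ℝ} (hN : 0 < N) :
    (fun k : ι → ℤ => (h (len k / N) : ℂ)).HasFiniteSupport :=
  hasFiniteSupport_of_box (R := ⌈N⌉₊) fun k hk => by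
    rw [hh.coeff_eq_zero hN (Nat.le_ceil N) k hk, Complex.ofReal_zero]

theorem kern_real {N : ℝ} (hN : 0 < N) (x : Torus ι) :
    ((kern h N x).re : ℂ) = kern h N x :=
  trigSum_real (hh.hasFiniteSupport_coeff hN) (fun k => by simp [len_neg]) x

theorem sigma_real {N : ℝ} (hN : 0 < N) (f : C(Torus ι, ℝ)) (x : Torus ι) :
    ((sigma h N f x).re : ℂ) = sigma h N f x := by
  refine trigSum_real ?_ (fun k => ?_) x
  · exact (hh.hasFiniteSupport_coeff hN).subset fun k hk hk' => hk (by simp_all)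
  · have : starRingEnd ℂ (fourierCoef f (-k)) = fourierCoef f k := by
      rw [fourierCoef, map_mul, ← integral_conj]
      simp [fourierCoef, expo_neg, Complex.conj_ofNat]
    rw [map_mul, this, len_neg, Complex.conj_ofReal]

/-- For `N ≤ 1` only `k = 0` contributes to the kernel, exactly as for `N = 1`. -/
theorem coeff_max_one {N : ℝ} (hN : 0 < N) (k : ι → ℤ) :
    h (len k / max N 1) = h (len k / N) := by
  rcases le_total 1 N with h1 | h1
  · rw [max_eq_left h1]
  · rw [max_eq_right h1]
    by_cases hk : k = 0
    · simp [hk, len_zero]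
    · have h2 := one_le_len hk
      have h3 : 1 ≤ len k / N := (one_le_div hN).2 (h1.trans h2)
      rw [hh.eq_zero _ (by rw [div_one]; exact h2.trans (le_abs_self _)),
        hh.eq_zero _ (h3.trans (le_abs_self _))]

theorem kern_max_one {N : ℝ} (hN : 0 < N) :
    (kern h (max N 1) : C(Torus ι, ℂ)) = kern h N := by
  simp only [kern, hh.coeff_max_one hN]

/-- `Φ_N(0)` is the sum of the coefficients, and those in the box of radius `N / (2 (|ι| + 1))`
are equal to `1`. -/
theorem exists_le_kern_zero (ι : Type*) [Fintype ι] :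
    ∃ c : ℝ, 0 < c ∧ ∀ N : ℝ, 1 ≤ N → c * N ^ Fintype.card ι ≤ (kern h N (0 : Torus ι)).re := by
  set d := Fintype.card ι with hd
  refine ⟨(1 / (2 * (d + 1))) ^ d, by positivity, fun N hN => ?_⟩
  have hN0 : 0 < N := by linarith
  have ha : ∀ k ∉ box ι ⌈N⌉₊, (h (len k / N) : ℂ) = 0 := fun k hk => by
    rw [hh.coeff_eq_zero hN0 (Nat.le_ceil N) k hk, Complex.ofReal_zero]
  rw [kern_eq_trigSum, trigSum_apply ha, Complex.re_sum]
  simp only [expo_apply_zero, mul_one, Complex.ofReal_re]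
  set r := ⌊N / (2 * (d + 1))⌋₊ with hr
  have hr1 : (r : ℝ) ≤ N / (2 * (d + 1)) := Nat.floor_le (by positivity)
  have hrN : r ≤ ⌈N⌉₊ := by
    refine (Nat.floor_le_floor (div_le_self hN0.le ?_)).trans (Nat.floor_le_ceil N)
    have : (0 : ℝ) ≤ d := by positivity
    linarith
  have hsub : box ι r ⊆ box ι ⌈N⌉₊ := fun k hk => mem_box.2 fun i =>
    (mem_box.1 hk i).trans (by exact_mod_cast hrN)
  calc (1 / (2 * (d + 1))) ^ d * N ^ d = (N / (2 * ((d : ℝ) + 1))) ^ d := by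
        rw [← mul_pow]; congr 1; ring
    _ ≤ (2 * r + 1) ^ d := by
        have := Nat.lt_floor_add_one (N / (2 * ((d : ℝ) + 1)))
        rw [← hr] at this
        have h0 : (0 : ℝ) ≤ r := by positivity
        exact pow_le_pow_left₀ (by positivity) (by linarith) _
    _ = ∑ k ∈ box ι r, (1 : ℝ) := by simp [card_box, hd]
    _ = ∑ k ∈ box ι r, h (len k / N) := by
        refine Finset.sum_congr rfl fun k hk => (hh.eq_one _ ?_).symm
        rw [abs_of_nonneg (div_nonneg (len_nonneg k) hN0.le), div_le_div_iff₀ hN0 two_pos]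
        have h1 : len k ≤ d * r := by
          refine (len_le_sum k).trans ?_
          have : ∀ i ∈ Finset.univ, |(k i : ℝ)| ≤ r := fun i _ => by
            exact_mod_cast mem_box.1 hk i
          simpa [hd] using Finset.sum_le_card_nsmul _ _ _ this
        rw [le_div_iff₀ (by positivity)] at hr1
        have h0 : (0 : ℝ) ≤ r := by positivity
        nlinarith
    _ ≤ ∑ k ∈ box ι ⌈N⌉₊, h (len k / N) :=
        Finset.sum_le_sum_of_subset_of_nonneg hsub fun k _ _ => (hh.mem_Icc _).1

end IsCutoff

open MeasureTheory

/-! ### The summability operator -/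

theorem integrable_torus {F : Torus ι → ℂ} (hF : Continuous F) : Integrable F :=
  hF.integrable_of_hasCompactSupport (HasCompactSupport.of_compactSpace F)

theorem integrable_torus_real {F : Torus ι → ℝ} (hF : Continuous F) : Integrable F :=
  hF.integrable_of_hasCompactSupport (HasCompactSupport.of_compactSpace F)

theorem Circ.integral_decay_le (N : ℝ) :
    ∫ t : Circ, N * (1 + (N * ‖t‖) ^ 2)⁻¹ ≤ Real.pi := by
  have hpi := Real.pi_pos
  rw [← AddCircle.intervalIntegral_preimage (2 * Real.pi) (-Real.pi)]
  have h1 : ∫ a in -Real.pi..-Real.pi + 2 * Real.pi, N * (1 + (N * ‖(a : Circ)‖) ^ 2)⁻¹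
      = ∫ a in -Real.pi..Real.pi, N * (1 + (N * a) ^ 2)⁻¹ := by
    rw [show -Real.pi + 2 * Real.pi = Real.pi by ring]
    refine intervalIntegral.integral_congr fun a ha => ?_
    rw [Set.uIcc_of_le (by linarith)] at ha
    have h2 : ‖(a : Circ)‖ = |a| := by
      rw [AddCircle.norm_coe_eq_abs_iff _ (by positivity), abs_of_pos Real.two_pi_pos,
        abs_le]
      constructor <;> linarith [ha.1, ha.2]
    simp only [h2, mul_pow, sq_abs]
  rw [h1, intervalIntegral.integral_const_mul,
    intervalIntegral.mul_integral_comp_mul_left (f := fun u => (1 + u ^ 2)⁻¹),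
    integral_inv_one_add_sq]
  linarith [Real.arctan_lt_pi_div_two (N * Real.pi), Real.neg_pi_div_two_lt_arctan (N * -Real.pi)]

theorem exists_integral_kern_le (ι : Type*) [Fintype ι] {h : ℝ → ℝ} (hh : IsCutoff h) :
    ∃ A, 0 < A ∧ ∀ N : ℝ, 0 < N → ∀ x : Torus ι, ∫ y, ‖kern h N (x - y)‖ ≤ A := by
  obtain ⟨K, hK0, hK⟩ := exists_kern_decay ι hh
  refine ⟨K * Real.pi ^ Fintype.card ι, by positivity, fun N hN x => ?_⟩
  rw [← hh.kern_max_one hN]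
  have hN1 : 1 ≤ max N 1 := le_max_right _ _
  revert hN1
  generalize max N 1 = N
  intro hN1
  have hN0 : 0 < N := by linarith
  have : (volume : Measure (Torus ι)).IsNegInvariant :=
    Measure.IsAddHaarMeasure.isNegInvariant_of_regular volume
  have hcont : ∀ i : ι, Continuous fun y : Torus ι => (1 + (N * ‖y i‖) ^ 2)⁻¹ := fun i =>
    Continuous.inv₀ (by fun_prop) fun y => by positivity
  have hcont' : ∀ i : ι, Continuous fun y : Torus ι => N * (1 + (N * ‖y i‖) ^ 2)⁻¹ := fun i =>
    (hcont i).const_mul N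
  calc ∫ y, ‖kern h N (x - y)‖ = ∫ y : Torus ι, ‖kern h N y‖ :=
        integral_sub_left_eq_self (fun y : Torus ι => ‖kern h N y‖) volume x
    _ ≤ ∫ y : Torus ι, K * ∏ i, N * (1 + (N * ‖y i‖) ^ 2)⁻¹ := by
        refine integral_mono (integrable_torus_real (by fun_prop)) (integrable_torus_real
          (continuous_const.mul (continuous_finsetProd _ fun i _ => hcont' i))) fun y => ?_
        refine (hK N hN1 y).trans ?_
        rw [Finset.prod_mul_distrib, Finset.prod_const, Finset.card_univ, ← mul_assoc, ← mul_assoc]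
        refine mul_le_of_le_one_right ?_ (inv_le_one_of_one_le₀ ?_)
        · exact mul_nonneg (by positivity) (Finset.prod_nonneg fun i _ => by positivity)
        · nlinarith [sq_nonneg (N * ‖y‖)]
    _ = K * ∏ i : ι, ∫ t : Circ, N * (1 + (N * ‖t‖) ^ 2)⁻¹ := by
        rw [integral_const_mul, integral_fintype_prod_volume_eq_prod
          (fun (_ : ι) (t : Circ) => N * (1 + (N * ‖t‖) ^ 2)⁻¹)]
    _ ≤ K * ∏ i : ι, Real.pi := by
        refine mul_le_mul_of_nonneg_left (Finset.prod_le_prod (fun i _ => ?_) fun i _ => ?_) hK0.le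
        · exact integral_nonneg fun t => by positivity
        · exact Circ.integral_decay_le N
    _ = K * Real.pi ^ Fintype.card ι := by simp

/-- The Fourier coefficients of a complex function. -/
def fourierCoefC (F : C(Torus ι, ℂ)) (k : ι → ℤ) : ℂ :=
  1 / (2 * (Real.pi : ℂ)) ^ Fintype.card ι * ∫ x : Torus ι, F x * expo (-k) x

/-- The summability operator on complex functions, needed because the trigonometric polynomials
in the degree of approximation are complex. -/
def sigmaC (h : ℝ → ℝ) (N : ℝ) (F : C(Torus ι, ℂ)) : C(Torus ι, ℂ) :=
  trigSum fun k => (h (len k / N) : ℂ) * fourierCoefC F k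

theorem sigmaC_toC (h : ℝ → ℝ) (N : ℝ) (f : C(Torus ι, ℝ)) :
    sigmaC h N (toC f) = sigma h N f := rfl

theorem fourierCoefC_add (F G : C(Torus ι, ℂ)) (k : ι → ℤ) :
    fourierCoefC (F + G) k = fourierCoefC F k + fourierCoefC G k := by
  simp only [fourierCoefC, ContinuousMap.add_apply, add_mul]
  rw [integral_add (integrable_torus (by fun_prop)) (integrable_torus (by fun_prop)), mul_add]

theorem fourierCoefC_smul (c : ℂ) (F : C(Torus ι, ℂ)) (k : ι → ℤ) :
    fourierCoefC (c • F) k = c * fourierCoefC F k := by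
  simp only [fourierCoefC, ContinuousMap.smul_apply, smul_eq_mul, mul_assoc]
  rw [integral_const_mul]
  ring

theorem Circ.integral_fourier {n : ℤ} (hn : n ≠ 0) : ∫ t : Circ, fourier n t = 0 := by
  -- translation by half a period of the integrand changes its sign
  have h1 := integral_add_right_eq_self (μ := volume) (fun t : Circ => (fourier n t : ℂ))
    ((2 * Real.pi / 2 / n : ℝ) : Circ)
  simp only [fourier_add_half_inv_index hn Real.two_pi_pos, integral_neg] at h1
  exact self_eq_neg.1 h1.symm

theorem integral_expo (k : ι → ℤ) :
    ∫ x : Torus ι, expo k x = if k = 0 then (2 * (Real.pi : ℂ)) ^ Fintype.card ι else 0 := by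
  simp only [expo_apply]
  rw [integral_fintype_prod_volume_eq_prod (fun (i : ι) (t : Circ) => (fourier (k i) t : ℂ))]
  split_ifs with hk
  · simp [hk, Measure.real, AddCircle.measure_univ, ENNReal.toReal_ofReal Real.pi_pos.le]
  · obtain ⟨i, hi⟩ := Function.ne_iff.1 hk
    exact Finset.prod_eq_zero (Finset.mem_univ i) (Circ.integral_fourier hi)

theorem fourierCoefC_expo (l k : ι → ℤ) :
    fourierCoefC (expo l) k = if k = l then 1 else 0 := by
  have hpi : (Real.pi : ℂ) ≠ 0 := by exact_mod_cast Real.pi_ne_zero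
  simp only [fourierCoefC, ← expo_add, integral_expo, ← sub_eq_add_neg, sub_eq_zero,
    eq_comm (a := l)]
  split_ifs
  · field_simp
  · simp

namespace IsCutoff

variable {h : ℝ → ℝ} (hh : IsCutoff h)

include hh

theorem sigmaC_apply {N : ℝ} (hN : 0 < N) (F : C(Torus ι, ℂ)) :
    sigmaC h N F = ∑ k ∈ box ι ⌈N⌉₊, ((h (len k / N) : ℂ) * fourierCoefC F k) • expo k :=
  trigSum_eq_sum fun k hk => by
    rw [hh.coeff_eq_zero hN (Nat.le_ceil N) k hk, Complex.ofReal_zero, zero_mul]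

theorem sigmaC_add {N : ℝ} (hN : 0 < N) (F G : C(Torus ι, ℂ)) :
    sigmaC h N (F + G) = sigmaC h N F + sigmaC h N G := by
  simp only [hh.sigmaC_apply hN, fourierCoefC_add, mul_add, add_smul, Finset.sum_add_distrib]

theorem sigmaC_smul {N : ℝ} (hN : 0 < N) (c : ℂ) (F : C(Torus ι, ℂ)) :
    sigmaC h N (c • F) = c • sigmaC h N F := by
  simp only [hh.sigmaC_apply hN, fourierCoefC_smul, Finset.smul_sum, smul_smul]
  refine Finset.sum_congr rfl fun k _ => ?_
  congr 1
  ring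

theorem sigmaC_expo {N : ℝ} (hN : 0 < N) {l : ι → ℤ} (hl : len l < N / 2) :
    sigmaC h N (expo l) = expo l := by
  classical
  have h1 : h (len l / N) = 1 := by
    refine hh.eq_one _ ?_
    rw [abs_of_nonneg (div_nonneg (len_nonneg l) hN.le), div_le_iff₀ hN]
    linarith
  rw [sigmaC, trigSum_eq_sum (s := {l})]
  · simp [fourierCoefC_expo, h1]
  · intro k hk
    have : k ≠ l := by simpa using hk
    simp [fourierCoefC_expo, this]

theorem sigmaC_trigPoly {N : ℝ} (hN : 0 < N) {P : C(Torus ι, ℂ)} (hP : P ∈ trigPoly ι (N / 2)) :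
    sigmaC h N P = P := by
  refine Submodule.span_induction ?_ ?_ ?_ ?_ hP
  · rintro _ ⟨k, hk, rfl⟩
    exact hh.sigmaC_expo hN hk
  · simpa using hh.sigmaC_smul hN 0 (0 : C(Torus ι, ℂ))
  · intro F G _ _ hF hG
    rw [hh.sigmaC_add hN, hF, hG]
  · intro c F _ hF
    rw [hh.sigmaC_smul hN, hF]

/-- The summability operator is convolution with the kernel. -/
theorem sigmaC_eq_integral {N : ℝ} (hN : 0 < N) (F : C(Torus ι, ℂ)) (x : Torus ι) :
    sigmaC h N F x
      = 1 / (2 * (Real.pi : ℂ)) ^ Fintype.card ι * ∫ y, F y * kern h N (x - y) := by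
  have ha : ∀ k ∉ box ι ⌈N⌉₊, (h (len k / N) : ℂ) = 0 := fun k hk => by
    rw [hh.coeff_eq_zero hN (Nat.le_ceil N) k hk, Complex.ofReal_zero]
  have h1 : ∀ y, F y * kern h N (x - y)
      = ∑ k ∈ box ι ⌈N⌉₊, (h (len k / N) : ℂ) * expo k x * (F y * expo (-k) y) := fun y => by
    rw [kern_eq_trigSum, trigSum_apply ha, Finset.mul_sum]
    refine Finset.sum_congr rfl fun k _ => ?_
    rw [expo_apply_sub]
    ring
  simp only [h1]
  rw [integral_finsetSum _ fun k _ => integrable_torus (by fun_prop), hh.sigmaC_apply hN,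
    ContinuousMap.sum_apply, Finset.mul_sum]
  refine Finset.sum_congr rfl fun k _ => ?_
  rw [integral_const_mul, ContinuousMap.smul_apply, smul_eq_mul, fourierCoefC]
  ring

theorem exists_norm_sigmaC_le (ι : Type*) [Fintype ι] :
    ∃ A, 0 < A ∧ ∀ N : ℝ, 0 < N → ∀ F : C(Torus ι, ℂ), ‖sigmaC h N F‖ ≤ A * ‖F‖ := by
  obtain ⟨A, hA0, hA⟩ := exists_integral_kern_le ι hh
  have hpi := Real.pi_pos
  refine ⟨1 / (2 * Real.pi) ^ Fintype.card ι * A, by positivity, fun N hN F => ?_⟩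
  rw [ContinuousMap.norm_le _ (by positivity)]
  intro x
  rw [hh.sigmaC_eq_integral hN, norm_mul, mul_assoc]
  have h1 : ‖1 / (2 * (Real.pi : ℂ)) ^ Fintype.card ι‖ = 1 / (2 * Real.pi) ^ Fintype.card ι := by
    simp [abs_of_pos hpi]
  rw [h1]
  gcongr
  calc ‖∫ y, F y * kern h N (x - y)‖ ≤ ∫ y, ‖F‖ * ‖kern h N (x - y)‖ := by
        refine norm_integral_le_of_norm_le (integrable_torus_real (by fun_prop))
          (Filter.Eventually.of_forall fun y => ?_)
        rw [norm_mul]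
        gcongr
        exact F.norm_coe_le_norm y
    _ = ‖F‖ * ∫ y, ‖kern h N (x - y)‖ := integral_const_mul _ _
    _ ≤ ‖F‖ * A := by gcongr; exact hA N hN x
    _ = A * ‖F‖ := mul_comm _ _

/-- Near-best approximation by the summability operator, since it reproduces the trigonometric
polynomials of degree less than `N / 2` and is bounded uniformly in `N`. -/
theorem exists_norm_sub_sigma_le (ι : Type*) [Fintype ι] :
    ∃ A, 0 < A ∧ ∀ N : ℝ, 0 < N → ∀ f : C(Torus ι, ℝ),
      ‖toC f - sigma h N f‖ ≤ A * degApprox (N / 2) f := by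
  obtain ⟨A, hA0, hA⟩ := hh.exists_norm_sigmaC_le ι
  refine ⟨1 + A, by positivity, fun N hN f => ?_⟩
  rw [← div_le_iff₀' (by positivity)]
  refine le_ciInf fun ⟨P, hP⟩ => ?_
  change _ ≤ ‖toC f - P‖
  rw [div_le_iff₀' (by positivity)]
  have h1 : sigma h N f = sigmaC h N (toC f - P) + P := by
    have := hh.sigmaC_add hN (toC f - P) P
    rwa [sub_add_cancel, hh.sigmaC_trigPoly hN hP, sigmaC_toC] at this
  rw [h1]
  calc ‖toC f - (sigmaC h N (toC f - P) + P)‖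
      = ‖(toC f - P) - sigmaC h N (toC f - P)‖ := by congr 1; abel
    _ ≤ ‖toC f - P‖ + ‖sigmaC h N (toC f - P)‖ := norm_sub_le _ _
    _ ≤ ‖toC f - P‖ + A * ‖toC f - P‖ := by gcongr; exact hA N hN _
    _ = _ := by ring

end IsCutoff

theorem degApprox_nonneg (n : ℝ) (f : C(Torus ι, ℝ)) : 0 ≤ degApprox n f :=
  Real.iInf_nonneg fun _ => norm_nonneg _

/-! ### Sums of the kernel over separated points -/

theorem exists_sum_cell_le : ∃ B : ℝ, 0 < B ∧
    ∀ K : Finset ℤ, ∑ m ∈ K, 4 * (1 + (m : ℝ) ^ 2)⁻¹ ≤ B := by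
  have h0 : Summable fun m : ℤ => 1 / (m : ℝ) ^ 2 := Real.summable_one_div_int_pow.2 one_lt_two
  have h1 : Summable fun m : ℤ => 4 * (1 + (m : ℝ) ^ 2)⁻¹ := by
    refine Summable.mul_left _ (h0.of_norm_bounded_eventually ?_)
    have : ∀ᶠ m : ℤ in Filter.cofinite, m ≠ 0 := (Set.finite_singleton (0 : ℤ)).compl_mem_cofinite
    filter_upwards [this] with m hm
    have hm' : 0 < (m : ℝ) ^ 2 := by positivity
    rw [Real.norm_of_nonneg (by positivity), one_div]
    gcongr
    linarith
  refine ⟨∑' m : ℤ, 4 * (1 + (m : ℝ) ^ 2)⁻¹ + 1, ?_, fun K => ?_⟩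
  · have : 0 ≤ ∑' m : ℤ, 4 * (1 + (m : ℝ) ^ 2)⁻¹ := tsum_nonneg fun m => by positivity
    linarith
  · have := h1.sum_le_tsum K fun m _ => by positivity
    linarith

/-- A sum of product weights over `δ`-separated points: a cube of side `δ` contains at most one
of the points, so that the sum is dominated by a sum over the lattice of cubes, which is a power
of a one-dimensional sum. -/
theorem exists_sum_weight_le (ι : Type*) [Fintype ι] : ∃ B : ℝ, 0 < B ∧ ∀ N δ : ℝ, 0 < N → 0 < δ →
    1 ≤ N * δ → ∀ s : Finset (Torus ι), (∀ p ∈ s, ∀ q ∈ s, p ≠ q → δ ≤ dist p q) →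
      ∀ z : Torus ι, ∑ p ∈ s, ∏ i, (1 + (N * ‖(z - p) i‖) ^ 2)⁻¹ ≤ B := by
  classical
  obtain ⟨B, hB0, hB⟩ := exists_sum_cell_le
  refine ⟨B ^ Fintype.card ι, by positivity, fun N δ hN hδ hNδ s hs z => ?_⟩
  choose r hr hr' using Circ.exists_rep
  -- the cube of side `δ` that holds the representative of `z - p`
  set cell : Torus ι → ι → ℤ := fun p i => ⌊r ((z - p) i) / δ⌋ with hcell
  have hinj : Set.InjOn cell s := by
    intro p hp q hq hpq
    by_contra hne
    refine absurd (hs p hp q hq hne) (not_le.2 ((dist_pi_lt_iff hδ).2 fun i => ?_))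
    have h1 : ((r ((z - q) i) - r ((z - p) i) : ℝ) : Circ) = p i - q i := by
      rw [AddCircle.coe_sub, hr, hr, Pi.sub_apply, Pi.sub_apply]
      abel
    rw [dist_eq_norm, ← h1]
    refine (Circ.norm_coe_le _).trans_lt ?_
    have h2 := Int.abs_sub_lt_one_of_floor_eq_floor (congrFun hpq i).symm
    rwa [← sub_div, abs_div, abs_of_pos hδ, div_lt_one hδ] at h2
  have hle : ∀ p i, (1 + (N * ‖(z - p) i‖) ^ 2)⁻¹ ≤ 4 * (1 + (cell p i : ℝ) ^ 2)⁻¹ := by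
    intro p i
    rw [← hr', ← div_eq_mul_inv, inv_eq_one_div, div_le_div_iff₀ (by positivity) (by positivity)]
    set t := r ((z - p) i)
    have h1 : |(cell p i : ℝ)| ≤ |t| / δ + 1 := by
      have e1 := Int.floor_le (t / δ)
      have e2 := Int.lt_floor_add_one (t / δ)
      have e3 := abs_div t δ
      rw [abs_of_pos hδ] at e3
      rw [← e3, abs_le]
      change -_ ≤ (⌊t / δ⌋ : ℝ) ∧ (⌊t / δ⌋ : ℝ) ≤ _
      constructor
      · linarith [neg_abs_le (t / δ)]
      · linarith [le_abs_self (t / δ)]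
    have h2 : |t| / δ ≤ N * |t| := by
      rw [div_le_iff₀ hδ]
      nlinarith [abs_nonneg t]
    have h3 : |(cell p i : ℝ)| ≤ N * |t| + 1 := h1.trans (by linarith)
    have h4 : (cell p i : ℝ) ^ 2 ≤ (N * |t| + 1) ^ 2 := sq_le_sq' (abs_le.1 h3).1 (abs_le.1 h3).2
    nlinarith [sq_nonneg (N * |t| - 1), sq_nonneg (N * |t|)]
  set K : Finset ℤ := Finset.univ.biUnion fun i => s.image fun p => cell p i with hK
  calc ∑ p ∈ s, ∏ i, (1 + (N * ‖(z - p) i‖) ^ 2)⁻¹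
      ≤ ∑ p ∈ s, ∏ i, 4 * (1 + (cell p i : ℝ) ^ 2)⁻¹ :=
        Finset.sum_le_sum fun p _ =>
          Finset.prod_le_prod (fun i _ => by positivity) fun i _ => hle p i
    _ = ∑ m ∈ s.image cell, ∏ i, 4 * (1 + (m i : ℝ) ^ 2)⁻¹ :=
        (Finset.sum_image (f := fun m : ι → ℤ => ∏ i, 4 * (1 + (m i : ℝ) ^ 2)⁻¹) hinj).symm
    _ ≤ ∑ m ∈ Fintype.piFinset fun _ : ι => K, ∏ i, 4 * (1 + (m i : ℝ) ^ 2)⁻¹ := by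
        refine Finset.sum_le_sum_of_subset_of_nonneg ?_
          fun m _ _ => Finset.prod_nonneg fun i _ => by positivity
        intro m hm
        obtain ⟨p, hp, rfl⟩ := Finset.mem_image.1 hm
        refine Fintype.mem_piFinset.2 fun i => ?_
        exact Finset.mem_biUnion.2 ⟨i, Finset.mem_univ i, Finset.mem_image_of_mem _ hp⟩
    _ = ∏ _i : ι, ∑ m ∈ K, 4 * (1 + (m : ℝ) ^ 2)⁻¹ :=
        (Finset.prod_univ_sum (fun _ : ι => K) fun _ m => 4 * (1 + (m : ℝ) ^ 2)⁻¹).symm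
    _ ≤ ∏ _i : ι, B :=
        Finset.prod_le_prod (fun i _ => Finset.sum_nonneg fun m _ => by positivity) fun i _ => hB K
    _ = B ^ Fintype.card ι := by simp

/-- For points that are well separated at scale `1 / N`, the interpolation matrix
`Φ_N(q - p)` is diagonally dominant, and the absolute values of the translates of the kernel sum
to at most a multiple of `Φ_N(0)`. -/
theorem IsCutoff.exists_sum_kern_le {h : ℝ → ℝ} (hh : IsCutoff h) (ι : Type*) [Fintype ι] :
    ∃ C, 0 < C ∧ ∃ D, 0 < D ∧ ∀ N : ℝ, 0 < N → 0 < (kern h N (0 : Torus ι)).re ∧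
      ∀ s : Finset (Torus ι), (∀ p ∈ s, ∀ q ∈ s, p ≠ q → C ≤ N * dist p q) →
        (∀ t ⊆ s, ∀ q ∈ s, q ∉ t →
          ∑ p ∈ t, ‖kern h N (q - p)‖ ≤ (kern h N (0 : Torus ι)).re / 2) ∧
        ∀ z, ∑ p ∈ s, ‖kern h N (z - p)‖ ≤ D * (kern h N (0 : Torus ι)).re := by
  obtain ⟨K, hK0, hK⟩ := exists_kern_decay ι hh
  obtain ⟨B, hB0, hB⟩ := exists_sum_weight_le ι
  obtain ⟨c, hc0, hc⟩ := hh.exists_le_kern_zero ι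
  set d := Fintype.card ι with hd
  -- the separation that makes the decay factor away from the origin at most `c / (2 K B)`
  set C : ℝ := 1 + 2 * (K * B) / c with hC
  have hC1 : 1 ≤ C := by
    have : 0 < 2 * (K * B) / c := by positivity
    linarith
  refine ⟨C, by linarith, K * B / c, by positivity, fun N hN => ?_⟩
  rw [← hh.kern_max_one hN]
  have hNmax : N ≤ max N 1 := le_max_left _ _
  have hN1 : 1 ≤ max N 1 := le_max_right _ _
  revert hNmax hN1
  generalize max N 1 = N'
  intro hNmax hN1
  have hN0 : 0 < N' := by linarith
  have hpos : 0 < c * N' ^ d := by positivity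
  have hcN := hc N' hN1
  refine ⟨hpos.trans_le hcN, fun s hs => ?_⟩
  have hs' : ∀ p ∈ s, ∀ q ∈ s, p ≠ q → C ≤ N' * dist p q := fun p hp q hq hpq =>
    (hs p hp q hq hpq).trans (by gcongr)
  have hw : ∀ t ⊆ s, ∀ z, ∑ p ∈ t, ∏ i, (1 + (N' * ‖(z - p) i‖) ^ 2)⁻¹ ≤ B := fun t ht z =>
    hB N' (C / N') hN0 (by positivity) (by rwa [mul_div_cancel₀ _ hN0.ne']) t
      (fun p hp q hq hpq => by
        rw [div_le_iff₀' hN0]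
        exact hs' p (ht hp) q (ht hq) hpq) z
  refine ⟨fun t ht q hq hqt => ?_, fun z => ?_⟩
  · calc ∑ p ∈ t, ‖kern h N' (q - p)‖
        ≤ ∑ p ∈ t, K * N' ^ d * ((∏ i, (1 + (N' * ‖(q - p) i‖) ^ 2)⁻¹) * (1 + C ^ 2)⁻¹) := by
          refine Finset.sum_le_sum fun p hp => (hK N' hN1 _).trans ?_
          have h1 : C ≤ N' * ‖q - p‖ := by
            rw [← dist_eq_norm]
            exact hs' q hq p (ht hp) fun e => hqt (e ▸ hp)
          have h2 : 0 ≤ ∏ i, (1 + (N' * ‖(q - p) i‖) ^ 2)⁻¹ :=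
            Finset.prod_nonneg fun i _ => by positivity
          gcongr
      _ = K * N' ^ d * (1 + C ^ 2)⁻¹ * ∑ p ∈ t, ∏ i, (1 + (N' * ‖(q - p) i‖) ^ 2)⁻¹ := by
          rw [Finset.mul_sum]
          exact Finset.sum_congr rfl fun p _ => by ring
      _ ≤ K * N' ^ d * (1 + C ^ 2)⁻¹ * B := by gcongr; exact hw t ht q
      _ = N' ^ d * (K * B * (1 + C ^ 2)⁻¹) := by ring
      _ ≤ N' ^ d * (c / 2) := by
          gcongr
          rw [← div_eq_mul_inv, div_le_div_iff₀ (by positivity) two_pos]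
          have h3 : 2 * (K * B) = (C - 1) * c := by rw [hC]; field_simp; ring
          have h4 : C - 1 ≤ 1 + C ^ 2 := by nlinarith
          nlinarith [mul_le_mul_of_nonneg_right h4 hc0.le]
      _ ≤ (kern h N' (0 : Torus ι)).re / 2 := by linarith
  · calc ∑ p ∈ s, ‖kern h N' (z - p)‖
        ≤ ∑ p ∈ s, K * N' ^ d * ∏ i, (1 + (N' * ‖(z - p) i‖) ^ 2)⁻¹ := by
          refine Finset.sum_le_sum fun p _ => (hK N' hN1 _).trans ?_
          have h2 : 0 ≤ ∏ i, (1 + (N' * ‖(z - p) i‖) ^ 2)⁻¹ :=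
            Finset.prod_nonneg fun i _ => by positivity
          refine mul_le_mul_of_nonneg_left (mul_le_of_le_one_right h2 ?_) (by positivity)
          exact inv_le_one_of_one_le₀ (by nlinarith [sq_nonneg (N' * ‖z - p‖)])
      _ = K * N' ^ d * ∑ p ∈ s, ∏ i, (1 + (N' * ‖(z - p) i‖) ^ 2)⁻¹ := by rw [Finset.mul_sum]
      _ ≤ K * N' ^ d * B := by gcongr; exact hw s subset_rfl z
      _ = K * B / c * (c * N' ^ d) := by field_simp
      _ ≤ K * B / c * (kern h N' (0 : Torus ι)).re := by gcongr

/-! ### Diagonally dominant systems -/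

/-- A bound for the solutions of a diagonally dominant system; with `R = 0` it gives uniqueness,
hence solvability. -/
theorem abs_coeff_le_of_dominant {α : Type*} {s : Finset α} {k : α → α → ℝ} {Φ : ℝ} (hΦ : 0 < Φ)
    (hdiag : ∀ q ∈ s, k q q = Φ)
    (hoff : ∀ t ⊆ s, ∀ q ∈ s, q ∉ t → ∑ p ∈ t, |k q p| ≤ Φ / 2) {a : α → ℝ} {R : ℝ}
    (hR : ∀ q ∈ s, |∑ p ∈ s, a p * k q p| ≤ R) : ∀ q ∈ s, |a q| ≤ 2 * R / Φ := by
  classical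
  intro q hq
  -- the largest coefficient is controlled by its own equation
  obtain ⟨m, hm, hmax⟩ := s.exists_max_image (fun p => |a p|) ⟨q, hq⟩
  refine (hmax q hq).trans ?_
  rw [le_div_iff₀ hΦ]
  have h1 : a m * Φ = ∑ p ∈ s, a p * k m p - ∑ p ∈ s.erase m, a p * k m p := by
    rw [← Finset.add_sum_erase s _ hm, hdiag m hm]
    ring
  have h2 : |∑ p ∈ s.erase m, a p * k m p| ≤ |a m| * (Φ / 2) := by
    calc |∑ p ∈ s.erase m, a p * k m p| ≤ ∑ p ∈ s.erase m, |a m| * |k m p| := by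
          refine (Finset.abs_sum_le_sum_abs _ _).trans (Finset.sum_le_sum fun p hp => ?_)
          rw [abs_mul]
          exact mul_le_mul_of_nonneg_right (hmax p (Finset.mem_of_mem_erase hp)) (abs_nonneg _)
      _ = |a m| * ∑ p ∈ s.erase m, |k m p| := by rw [Finset.mul_sum]
      _ ≤ |a m| * (Φ / 2) := mul_le_mul_of_nonneg_left
          (hoff _ (Finset.erase_subset _ _) m hm (Finset.notMem_erase _ _)) (abs_nonneg _)
  have h3 : |a m| * Φ ≤ R + |a m| * (Φ / 2) := by
    calc |a m| * Φ = |a m * Φ| := by rw [abs_mul, abs_of_pos hΦ]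
      _ ≤ _ := by rw [h1]; exact (abs_sub _ _).trans (add_le_add (hR m hm) h2)
  linarith

theorem exists_solution_of_dominant {α : Type*} {s : Finset α} {k : α → α → ℝ} {Φ : ℝ}
    (hΦ : 0 < Φ) (hdiag : ∀ q ∈ s, k q q = Φ)
    (hoff : ∀ t ⊆ s, ∀ q ∈ s, q ∉ t → ∑ p ∈ t, |k q p| ≤ Φ / 2) (b : α → ℝ) :
    ∃ a : α → ℝ, ∀ q ∈ s, ∑ p ∈ s, a p * k q p = b q := by
  classical
  let A : (s → ℝ) →ₗ[ℝ] (s → ℝ) := Matrix.toLin' (Matrix.of fun q p : s => k q p)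
  have hA : ∀ u q, A u q = ∑ p : s, u p * k q p := fun u q => by
    simp only [A, Matrix.toLin'_apply, Matrix.mulVec, dotProduct, Matrix.of_apply]
    exact Finset.sum_congr rfl fun p _ => mul_comm _ _
  have hext : ∀ (u : s → ℝ) (q : α), ∑ p : s, u p * k q p
      = ∑ p ∈ s, (if hp : p ∈ s then u ⟨p, hp⟩ else 0) * k q p := fun u q => by
    rw [← Finset.sum_coe_sort s]
    refine Finset.sum_congr rfl fun p _ => ?_
    rw [dif_pos p.2]
  have hinj : Function.Injective A := by
    refine (injective_iff_map_eq_zero A).2 fun u hu => ?_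
    ext q
    have := abs_coeff_le_of_dominant hΦ hdiag hoff (R := 0)
      (a := fun p => if hp : p ∈ s then u ⟨p, hp⟩ else 0) (fun q hq => by
        rw [← hext, ← hA u ⟨q, hq⟩, hu]
        simp) q q.2
    simpa using this
  obtain ⟨u, hu⟩ := LinearMap.injective_iff_surjective.1 hinj fun q => b q
  refine ⟨fun p => if hp : p ∈ s then u ⟨p, hp⟩ else 0, fun q hq => ?_⟩
  rw [← hext, ← hA u ⟨q, hq⟩, hu]

/-! ### Interpolation at one node -/

theorem trigSum_mem_trigPoly {n : ℝ} {a : (ι → ℤ) → ℂ} (ha : ∀ k, a k ≠ 0 → len k < n) :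
    trigSum a ∈ trigPoly ι n := by
  refine finsum_induction (· ∈ trigPoly ι n) (zero_mem _) (fun _ _ => add_mem) fun k => ?_
  by_cases hk : a k = 0
  · simp [hk]
  · exact Submodule.smul_mem _ _ (Submodule.subset_span ⟨k, ha k hk, rfl⟩)

theorem trigSum_sub {a : (ι → ℤ) → ℂ} (ha : a.HasFiniteSupport) (x p : Torus ι) :
    trigSum a (x - p) = trigSum (fun k => a k * expo (-k) p) x := by
  rw [trigSum_apply_finsum ha, trigSum_apply_finsum]
  · refine finsum_congr fun k => ?_
    rw [expo_apply_sub]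
    ring
  · exact ha.subset fun k hk hk' => hk (by simp_all)

omit [Fintype ι] in
theorem norm_toC (f : C(Torus ι, ℝ)) : ‖toC f‖ = ‖f‖ := by
  refine le_antisymm ?_ ?_
  · refine (ContinuousMap.norm_le _ (norm_nonneg _)).2 fun x => ?_
    change ‖(f x : ℂ)‖ ≤ _
    rw [Complex.norm_real]
    exact f.norm_coe_le_norm x
  · refine (ContinuousMap.norm_le _ (norm_nonneg _)).2 fun x => ?_
    rw [← Complex.norm_real]
    exact (toC f).norm_coe_le_norm x

/-- The real function `Re σ_N(f) = σ_N(f)`. -/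
def sigmaRe (h : ℝ → ℝ) (N : ℝ) (f : C(Torus ι, ℝ)) : C(Torus ι, ℝ) :=
  ⟨fun x => (sigma h N f x).re, by fun_prop⟩

namespace IsCutoff

variable {h : ℝ → ℝ} (hh : IsCutoff h)

include hh

theorem coeff_ne_zero {N : ℝ} (hN : 0 < N) {k : ι → ℤ} (hk : h (len k / N) ≠ 0) : len k < N := by
  by_contra hk'
  rw [not_lt, ← one_le_div hN] at hk'
  exact hk (hh.eq_zero _ (hk'.trans (le_abs_self _)))

theorem sigma_mem {N : ℝ} (hN : 0 < N) (f : C(Torus ι, ℝ)) : sigma h N f ∈ trigPoly ι N :=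
  trigSum_mem_trigPoly fun k hk => hh.coeff_ne_zero hN fun hk' => hk (by simp [hk'])

theorem kern_translate_mem {N : ℝ} (hN : 0 < N) (p : Torus ι) :
    ∃ F ∈ trigPoly ι N, ∀ z, F z = kern h N (z - p) :=
  ⟨_, trigSum_mem_trigPoly fun k hk => hh.coeff_ne_zero hN fun hk' => hk (by simp [hk']),
    fun z => (trigSum_sub (hh.hasFiniteSupport_coeff hN) z p).symm⟩

theorem norm_sub_sigmaRe {N : ℝ} (hN : 0 < N) (f : C(Torus ι, ℝ)) :
    ‖f - sigmaRe h N f‖ = ‖toC f - sigma h N f‖ := by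
  rw [← norm_toC]
  congr 1
  ext x
  change ((f x - (sigma h N f x).re : ℝ) : ℂ) = (f x : ℂ) - sigma h N f x
  rw [Complex.ofReal_sub, hh.sigma_real hN]

/-- The kernel and `σ_N(f)` are real valued, so the defining equations can be read over `ℝ`. -/
theorem isTSharp_iff {N : ℝ} (hN : 0 < N) (f : C(Torus ι, ℝ)) {M : ℕ} (x : Fin M → Torus ι)
    (y : Fin M → ℝ) (T : C(Torus ι, ℝ)) :
    IsTSharp h N f x y T ↔ ∃ a : Torus ι → ℝ,
      (∀ l, ∑ p ∈ (Set.finite_range x).toFinset, a p * (kern h N (x l - p)).re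
        = y l - sigmaRe h N f (x l)) ∧
      ∀ z, T z = sigmaRe h N f z
        + ∑ p ∈ (Set.finite_range x).toFinset, a p * (kern h N (z - p)).re := by
  have h1 : ∀ (a : Torus ι → ℝ) z, ∑ p ∈ (Set.finite_range x).toFinset, (a p : ℂ) * kern h N (z - p)
      = ((∑ p ∈ (Set.finite_range x).toFinset, a p * (kern h N (z - p)).re : ℝ) : ℂ) := by
    intro a z
    push_cast
    simp only [hh.kern_real hN]
  have h2 : ∀ z, sigma h N f z = ((sigmaRe h N f z : ℝ) : ℂ) := fun z => (hh.sigma_real hN f z).symm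
  unfold IsTSharp
  simp only [h1, h2]
  norm_cast

/-- Interpolation by translates of the kernel at a single node: existence, uniqueness, degree,
interpolation property and near-best approximation. -/
theorem exists_interpolation (ι : Type*) [Fintype ι] :
    ∃ C, 0 < C ∧ ∃ c, 0 < c ∧ ∀ N : ℝ, 0 < N → ∀ (f : C(Torus ι, ℝ)) (M : ℕ)
      (x : Fin M → Torus ι) (y : Fin M → ℝ), (∀ i j, x i = x j → y i = y j) →
      (∀ i j, x i ≠ x j → C ≤ N * dist (x i) (x j)) →
      (∃! T, IsTSharp h N f x y T) ∧ ∀ T, IsTSharp h N f x y T →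
        toC T ∈ trigPoly ι N ∧ (∀ j, T (x j) = y j) ∧
        ∀ ε, 0 ≤ ε → (∀ j, |y j - f (x j)| ≤ ε) → ‖f - T‖ ≤ c * (ε + degApprox (N / 2) f) := by
  obtain ⟨C, hC0, D, hD0, hCD⟩ := hh.exists_sum_kern_le ι
  obtain ⟨A, hA0, hA⟩ := hh.exists_norm_sub_sigma_le ι
  refine ⟨C, hC0, A + 2 * D * (1 + A), by positivity, fun N hN f M x y hxy hsep => ?_⟩
  obtain ⟨hΦ, hs⟩ := hCD N hN
  set s := (Set.finite_range x).toFinset with hsdef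
  set Φ := (kern h N (0 : Torus ι)).re with hΦdef
  have hmem : ∀ l, x l ∈ s := fun l => by simp [s]
  have hex : ∀ q ∈ s, ∃ l, x l = q := fun q hq => by simpa [s] using hq
  obtain ⟨hoff, hsum⟩ := hs s fun p hp q hq hpq => by
    obtain ⟨i, rfl⟩ := hex p hp
    obtain ⟨j, rfl⟩ := hex q hq
    exact hsep i j hpq
  have hdiag : ∀ q ∈ s, (fun q p : Torus ι => (kern h N (q - p)).re) q q = Φ := fun q _ => by
    simp [hΦdef]
  have hoff' : ∀ t ⊆ s, ∀ q ∈ s, q ∉ t →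
      ∑ p ∈ t, |(fun q p : Torus ι => (kern h N (q - p)).re) q p| ≤ Φ / 2 :=
    fun t ht q hq hqt =>
      (Finset.sum_le_sum fun p _ => Complex.abs_re_le_norm _).trans (hoff t ht q hq hqt)
  refine ⟨existsUnique_of_exists_of_unique ?_ ?_, ?_⟩
  · have hy : ∀ l, Function.extend x y 0 (x l) = y l := fun l =>
      Function.FactorsThrough.extend_apply (fun i j => hxy i j) 0 l
    obtain ⟨a, ha⟩ := exists_solution_of_dominant hΦ hdiag hoff'
      fun q => Function.extend x y 0 q - sigmaRe h N f q
    refine ⟨⟨fun z => sigmaRe h N f z + ∑ p ∈ s, a p * (kern h N (z - p)).re, by fun_prop⟩,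
      (hh.isTSharp_iff hN f x y _).2 ⟨a, fun l => ?_, fun z => rfl⟩⟩
    rw [← hy l]
    exact ha _ (hmem l)
  · intro T T' hT hT'
    obtain ⟨a, ha, hTa⟩ := (hh.isTSharp_iff hN f x y T).1 hT
    obtain ⟨a', ha', hTa'⟩ := (hh.isTSharp_iff hN f x y T').1 hT'
    have h0 : ∀ q ∈ s, a q = a' q := fun q hq => by
      have := abs_coeff_le_of_dominant hΦ hdiag hoff' (a := a - a') (R := 0) (fun q hq => by
        obtain ⟨l, rfl⟩ := hex q hq
        simp only [Pi.sub_apply, sub_mul, Finset.sum_sub_distrib]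
        rw [ha l, ha' l, sub_self, abs_zero]) q hq
      simpa [sub_eq_zero] using this
    ext z
    rw [hTa, hTa']
    congr 1
    exact Finset.sum_congr rfl fun p hp => by rw [h0 p hp]
  · intro T hT
    obtain ⟨a, ha, hTa⟩ := (hh.isTSharp_iff hN f x y T).1 hT
    refine ⟨?_, fun j => by rw [hTa, ha]; ring, fun ε hε hεy => ?_⟩
    · choose F hF hFk using fun p : Torus ι => hh.kern_translate_mem hN p
      obtain ⟨b, -, hb⟩ := hT
      have : toC T = sigma h N f + ∑ p ∈ s, (b p : ℂ) • F p := by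
        ext z
        rw [ContinuousMap.add_apply, ContinuousMap.sum_apply]
        simp only [ContinuousMap.smul_apply, smul_eq_mul, hFk]
        exact hb z
      rw [this]
      exact add_mem (hh.sigma_mem hN f) (sum_mem fun p _ => Submodule.smul_mem _ _ (hF p))
    · set E := degApprox (N / 2) f with hE
      have hE0 : 0 ≤ E := degApprox_nonneg _ _
      have hσ : ∀ z, |f z - sigmaRe h N f z| ≤ A * E := fun z =>
        ((f - sigmaRe h N f).norm_coe_le_norm z).trans
          ((hh.norm_sub_sigmaRe hN f).trans_le (hA N hN f))
      have hR : ∀ q ∈ s, |∑ p ∈ s, a p * (kern h N (q - p)).re| ≤ ε + A * E := fun q hq => by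
        obtain ⟨l, rfl⟩ := hex q hq
        rw [ha l]
        have := abs_add_le (y l - f (x l)) (f (x l) - sigmaRe h N f (x l))
        rw [sub_add_sub_cancel] at this
        linarith [hεy l, hσ (x l)]
      have hab := abs_coeff_le_of_dominant hΦ hdiag hoff' hR
      refine (ContinuousMap.norm_le _ (by positivity)).2 fun z => ?_
      rw [ContinuousMap.sub_apply, hTa, Real.norm_eq_abs]
      have h1 : |∑ p ∈ s, a p * (kern h N (z - p)).re| ≤ 2 * D * (ε + A * E) := by
        calc |∑ p ∈ s, a p * (kern h N (z - p)).re|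
            ≤ ∑ p ∈ s, 2 * (ε + A * E) / Φ * ‖kern h N (z - p)‖ := by
              refine (Finset.abs_sum_le_sum_abs _ _).trans (Finset.sum_le_sum fun p hp => ?_)
              rw [abs_mul]
              exact mul_le_mul (hab p hp) (Complex.abs_re_le_norm _) (abs_nonneg _) (by positivity)
          _ = 2 * (ε + A * E) / Φ * ∑ p ∈ s, ‖kern h N (z - p)‖ := by rw [Finset.mul_sum]
          _ ≤ 2 * (ε + A * E) / Φ * (D * Φ) := by gcongr; exact hsum z
          _ = 2 * D * (ε + A * E) := by field_simp
      have h2 := abs_sub (f z - sigmaRe h N f z) (∑ p ∈ s, a p * (kern h N (z - p)).re)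
      rw [sub_sub] at h2
      have h3 := hσ z
      nlinarith [mul_nonneg hA0.le hε, mul_nonneg hD0.le hE0,
        mul_nonneg (mul_nonneg hD0.le hA0.le) hε]

end IsCutoff

namespace CompDAG

/-! ### Propagation through the network -/

variable {V : Type*}

theorem ne_sink_of_adj (G : CompDAG V) {u v : V} (huv : G.graph.Adj u v) : u ≠ G.sink :=
  fun hu => (G.sink_iff u).2 hu v huv

/-- If the constituent functions of `T` agree with those of `f`, off the sink, at the points seen
when `f` is evaluated, then every node sees the same point for `T` as for `f`. -/
theorem seen_eq_of_interpolates [Finite V] (G : CompDAG V) {f T : G.Fn} {x : G.Input}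
    (hT : ∀ v, v ≠ G.sink → T v (G.seen f x v) = f v (G.seen f x v)) (v : V) :
    G.seen T x v = G.seen f x v := by
  induction v using G.wf.induction with
  | _ v ih =>
    funext i
    rcases i with ⟨u, hu⟩ | i
    · change ((G.eval T x u : ℝ) : Circ) = ((G.eval f x u : ℝ) : Circ)
      rw [eval_eq, eval_eq, ih u hu, hT u (G.ne_sink_of_adj hu)]
    · rfl

/-- Reduction mod `2π` is a contraction, so that errors at the children of `v` are passed on to the
input of `v` without amplification. -/
theorem dist_seen_le [Fintype V] (G : CompDAG V) {f T : G.Fn} {x : G.Input} {v : V} {r : ℝ}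
    (hr : 0 ≤ r) (h : ∀ u, G.graph.Adj u v → |G.eval f x u - G.eval T x u| ≤ r) :
    dist (G.seen f x v) (G.seen T x v) ≤ r := by
  refine (dist_pi_le_iff hr).2 fun i => ?_
  rcases i with ⟨u, hu⟩ | i
  · change dist ((G.eval f x u : ℝ) : Circ) ((G.eval T x u : ℝ) : Circ) ≤ r
    rw [dist_eq_norm, ← AddCircle.coe_sub]
    exact (Circ.norm_coe_le _).trans (h u hu)
  · change dist (x v i) (x v i) ≤ r
    rwa [dist_self]

/-- The error of the output at each node is bounded by a multiple of the total error of the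
constituent functions, uniformly over all `f` whose constituents at the inner nodes are
`L`-Lipschitz. No regularity of `T` is needed. -/
theorem exists_abs_eval_sub_le [Fintype V] (G : CompDAG V) (L : ℝ≥0) (v : V) :
    ∃ B, 0 ≤ B ∧ ∀ f T : G.Fn, (∀ v, ¬ G.IsSource v → LipschitzWith L (f v)) →
      ∀ x, |G.eval f x v - G.eval T x v| ≤ B * G.norm (f - T) := by
  induction v using G.wf.induction with
  | _ v ih =>
    choose B hB0 hB using fun u : {u // G.graph.Adj u v} => ih u.1 u.2
    obtain ⟨b, hb⟩ := Finite.exists_le B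
    refine ⟨L * max b 0 + 1, by positivity, fun f T hf x => ?_⟩
    have hn : ∀ w, ‖f w - T w‖ ≤ G.norm (f - T) := fun w =>
      Finset.single_le_sum (f := fun w => ‖(f - T) w‖) (fun w _ => norm_nonneg _)
        (Finset.mem_univ w)
    have hn0 : 0 ≤ G.norm (f - T) := (norm_nonneg _).trans (hn v)
    have hchild : ∀ u, G.graph.Adj u v →
        |G.eval f x u - G.eval T x u| ≤ max b 0 * G.norm (f - T) := fun u hu =>
      (hB ⟨u, hu⟩ f T hf x).trans
        (mul_le_mul_of_nonneg_right ((hb ⟨u, hu⟩).trans (le_max_left _ _)) hn0)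
    have h1 : |f v (G.seen f x v) - f v (G.seen T x v)| ≤ L * (max b 0 * G.norm (f - T)) := by
      by_cases hv : G.IsSource v
      · -- a source sees the outside input only, whatever the constituent functions are
        have : G.seen f x v = G.seen T x v :=
          dist_le_zero.1 (G.dist_seen_le le_rfl fun u hu => absurd hu (hv u))
        rw [this, sub_self, abs_zero]
        positivity
      · rw [← Real.dist_eq]
        refine ((hf v hv).dist_le_mul _ _).trans ?_
        gcongr
        exact G.dist_seen_le (by positivity) hchild
    have h2 : |f v (G.seen T x v) - T v (G.seen T x v)| ≤ G.norm (f - T) :=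
      ((f v - T v).norm_coe_le_norm _).trans (hn v)
    rw [eval_eq, eval_eq]
    have := abs_add_le (f v (G.seen f x v) - f v (G.seen T x v))
      (f v (G.seen T x v) - T v (G.seen T x v))
    rw [sub_add_sub_cancel] at this
    linarith

theorem exists_outputDist_le [Fintype V] (G : CompDAG V) (L : ℝ≥0) :
    ∃ B, 0 ≤ B ∧ ∀ f T : G.Fn, (∀ v, ¬ G.IsSource v → LipschitzWith L (f v)) →
      G.outputDist f T ≤ B * G.norm (f - T) := by
  choose B hB0 hB using G.exists_abs_eval_sub_le L
  refine ⟨∑ v, B v, Finset.sum_nonneg fun v _ => hB0 v, fun f T hf => ?_⟩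
  rw [outputDist, Finset.sum_mul]
  exact Finset.sum_le_sum fun v _ => ciSup_le (hB v f T hf)

theorem noise_nonneg [Finite V] (G : CompDAG V) (f : G.Fn) {M : ℕ} (x : Fin M → G.Input)
    (y : Fin M → ℝ) : 0 ≤ G.noise f x y :=
  Real.iSup_nonneg fun _ => abs_nonneg _

theorem abs_sub_le_noise [Finite V] (G : CompDAG V) (f : G.Fn) {M : ℕ} (x : Fin M → G.Input)
    (y : Fin M → ℝ) (j : Fin M) : |y j - G.eval f (x j) G.sink| ≤ G.noise f x y :=
  le_ciSup (f := fun j => |y j - G.eval f (x j) G.sink|) (Set.finite_range _).bddAbove j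

end CompDAG

theorem le_mul_dist_of_div_einfsep_le {X : Type*} [PseudoMetricSpace X] {s : Set X} {C N : ℝ}
    (hN : 0 < N) (h : ENNReal.ofReal C / s.einfsep ≤ ENNReal.ofReal N) {p q : X}
    (hp : p ∈ s) (hq : q ∈ s) (hpq : p ≠ q) : C ≤ N * dist p q := by
  have h1 : s.einfsep ≤ ENNReal.ofReal (dist p q) := by
    rw [← edist_dist]
    exact Set.einfsep_le_edist_of_mem hp hq hpq
  have h2 : ENNReal.ofReal C ≤ ENNReal.ofReal N * s.einfsep :=
    (ENNReal.div_le_iff_le_mul (Or.inr ENNReal.ofReal_ne_top)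
      (Or.inr (by simpa using hN))).1 h
  have h3 : ENNReal.ofReal C ≤ ENNReal.ofReal (N * dist p q) := by
    rw [ENNReal.ofReal_mul hN.le]
    exact h2.trans (by gcongr)
  exact (ENNReal.ofReal_le_ofReal_iff (by positivity)).1 h3

end DeepTrig

end

theorem theorem4p1 {V : Type*} [Fintype V] (G : DeepTrig.CompDAG V)
    (h : ℝ → ℝ) (hh : DeepTrig.IsCutoff h) :
    ∃ C : ℝ, 0 < C ∧ ∀ L : ℝ≥0, ∃ c : ℝ, 0 < c ∧
      ∀ f : G.Fn, (∀ v, ¬ G.IsSource v → LipschitzWith L (f v)) →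
      ∀ N : V → ℝ, (∀ v, 0 < N v) →
      ∀ (M : ℕ) (x : Fin M → G.Input) (y : Fin M → ℝ),
        (∀ i j, G.seen f (x i) G.sink = G.seen f (x j) G.sink → y i = y j) →
        (∀ v, ENNReal.ofReal C / (G.points f x v).einfsep ≤ ENNReal.ofReal (N v)) →
        (∃! T : G.Fn, G.IsTSharp h N f x y T) ∧
        ∀ T : G.Fn, G.IsTSharp h N f x y T →
          G.IsTrigPoly N T ∧
          (∀ j, G.eval T (x j) G.sink = y j) ∧
          G.norm (f - T) ≤ c * (G.noise f x y + G.degApprox (fun v => N v / 2) f) ∧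
          G.outputDist f T ≤ c * (G.noise f x y + G.degApprox (fun v => N v / 2) f) := by
  classical
  choose C hC0 c hc0 hnode using fun v => hh.exists_interpolation (G.Inp v)
  have hCpos : 0 < ∑ v, C v := Finset.sum_pos (fun v _ => hC0 v) ⟨G.sink, Finset.mem_univ _⟩
  have hcpos : 0 < ∑ v, c v := Finset.sum_pos (fun v _ => hc0 v) ⟨G.sink, Finset.mem_univ _⟩
  refine ⟨∑ v, C v, hCpos, fun L => ?_⟩
  obtain ⟨B, hB0, hB⟩ := G.exists_outputDist_le L
  refine ⟨(1 + B) * ∑ v, c v, by positivity, fun f hf N hN M x y hy hsep => ?_⟩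
  have hlabel : ∀ v i j, G.seen f (x i) v = G.seen f (x j) v →
      (if v = G.sink then y i else f v (G.seen f (x i) v))
        = if v = G.sink then y j else f v (G.seen f (x j) v) := by
    intro v i j hij
    split_ifs with hv
    · subst hv; exact hy i j hij
    · rw [hij]
  have hdist : ∀ v i j, G.seen f (x i) v ≠ G.seen f (x j) v →
      C v ≤ N v * dist (G.seen f (x i) v) (G.seen f (x j) v) := fun v i j hij =>
    (Finset.single_le_sum (fun v _ => (hC0 v).le) (Finset.mem_univ v)).trans
      (DeepTrig.le_mul_dist_of_div_einfsep_le (hN v) (hsep v) ⟨i, rfl⟩ ⟨j, rfl⟩ hij)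
  have hv := fun v => hnode v (N v) (hN v) (f v) M (fun j => G.seen f (x j) v)
    (fun j => if v = G.sink then y j else f v (G.seen f (x j) v)) (hlabel v) (hdist v)
  refine ⟨?_, fun T hT => ?_⟩
  · choose T hT hTu using fun v => (hv v).1
    refine ⟨T, fun v => ?_, fun T' hT' => funext fun v => hTu v _ ?_⟩
    · convert hT v
    · convert hT' v
  · have hT' : ∀ v, _ := fun v => (hv v).2 (T v) (by convert hT v)
    have hnorm : G.norm (f - T)
        ≤ (∑ v, c v) * (G.noise f x y + G.degApprox (fun v => N v / 2) f) := by
      rw [DeepTrig.CompDAG.norm, Finset.sum_mul]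
      refine Finset.sum_le_sum fun v _ => ?_
      refine ((hT' v).2.2 (G.noise f x y) (G.noise_nonneg f x y) fun j => ?_).trans ?_
      · split_ifs with hv
        · subst hv
          rw [← DeepTrig.CompDAG.eval_eq]
          exact G.abs_sub_le_noise f x y j
        · rw [sub_self, abs_zero]
          exact G.noise_nonneg f x y
      · refine mul_le_mul_of_nonneg_left (add_le_add le_rfl ?_) (hc0 v).le
        exact Finset.single_le_sum (f := fun v => DeepTrig.degApprox (N v / 2) (f v))
          (fun v _ => DeepTrig.degApprox_nonneg _ _) (Finset.mem_univ v)
    set D := G.noise f x y + G.degApprox (fun v => N v / 2) f with hD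
    have hD0 : 0 ≤ D := add_nonneg (G.noise_nonneg f x y)
      (Finset.sum_nonneg fun v _ => DeepTrig.degApprox_nonneg _ _)
    refine ⟨fun v => (hT' v).1, fun j => ?_, ?_, ?_⟩
    · rw [DeepTrig.CompDAG.eval_eq, G.seen_eq_of_interpolates fun v hv => ?_]
      · simpa using (hT' G.sink).2.1 j
      · simpa [hv] using (hT' v).2.1 j
    · refine hnorm.trans ?_
      have := mul_nonneg hB0 (mul_nonneg hcpos.le hD0)
      linarith
    · have h1 := (hB f T hf).trans (mul_le_mul_of_nonneg_left hnorm hB0)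
      have h2 := mul_nonneg hcpos.le hD0
      linarith
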